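/- Let $F,G\in\mathbf C^{p\times n}$ and let $\Phi,\Psi$ be Hermitian $2\times2$ matrices with $\det\Phi<0$. Put $q_M(\mu,\nu)=\begin{bmatrix}\mu\\ \nu\end{bmatrix}^H M\begin{bmatrix}\mu\\ \nu\end{bmatrix}$ and $$\mathcal C=\{(\mu,\nu)\in\mathbf C^2 \mid (\mu,\nu)\ne0,\ q_\Phi(\mu,\nu)=0,\ q_\Psi(\mu,\nu)\le0\}.$$ Assume that $\mathcal C$, read in homogeneous coordinates, is neither empty nor a single point, i.e., it contains two nonproportional pairs. If $q_\Psi\le 0$ holds at every nonzero solution of $q_\Phi=0$ (the line or circle case), let $\mathcal C^\circ=\mathcal C$; otherwise (the segment case) let $\mathcal C^\circ=\{(\mu,\nu)\in\mathcal C\mid q_\Psi(\mu,\nu)<0\}$. Call a Hermitian $X\in\mathbf C^{n\times n}$ strictly feasible if $X\succ0$, $$\Phi_{11}FXF^H+\Phi_{21}FXG^H+\Phi_{12}GXF^H+\Phi_{22}GXG^H=0,$$ and, in the segment case, also $$\Psi_{11}FXF^H+\Psi_{21}FXG^H+\Psi_{12}GXF^H+\Psi_{22}GXG^H\prec0.$$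 In the line or circle case, assume in addition that the $p\times 2n$ matrix $[\,F\ \ G\,]$ has rank $p$ (that is, the rows of the pencil $\lambda G-F$ are linearly independent over $\mathbf C$). A Kronecker canonical form of $\lambda G-F$ is given by nonsingular $P,Q$ such that $P(\lambda G-F)Q$ is block diagonal with blocks $L_{\eta_1}(\lambda)^T,\dots,L_{\eta_l}(\lambda)^T$, $\lambda B-A$, $L_{\epsilon_1}(\lambda),\dots,L_{\epsilon_r}(\lambda)$, where $L_k(\lambda)=\lambda\,[\,I_k\ \ 0\,]-[\,0\ \ I_k\,]$ is $k\times(k+1)$, $k\ge0$, and $\lambda B-A$ is a regular pencil (square of some size $m\ge 0$, with $\det(\lambda B-A)\not\equiv0$). The generalized eigenvalues of $\lambda G-F$, with their multiplicities, are those of $\lambda B-A$: a finite one is a root $\lambda$ of $\det(\lambda B-A)$, with algebraic multiplicity its multiplicity as a root and geometric multiplicity $\dim\ker(\lambda B-A)$; infinity is one if $\det B=0$, with algebraic multiplicity $m-\deg\det(\lambda B-A)$ and geometric multiplicity $\dim\ker B$. The normal rank of $\lambda G-F$ is $\max_{\lambda\in\mathbf C}\operatorname{rank}(\lambda G-F)$.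 Then there exists a strictly feasible $X$ if and only if the following two conditions hold. 1. The normal rank of $\lambda G-F$ is $p$. 2. All generalized eigenvalues of $\lambda G-F$ are nondefective (algebraic multiplicity equals geometric multiplicity) and lie in $\mathcal C^\circ$, i.e., $(\lambda,1)\in\mathcal C^\circ$ for each finite generalized eigenvalue $\lambda$, and $(1,0)\in\mathcal C^\circ$ if infinity is a generalized eigenvalue. The equivalence holds both with condition 2 read as "some Kronecker canonical form of $\lambda G-F$ exists with these properties" and with condition 2 read for any given Kronecker canonical form. For any Kronecker canonical form, condition 1 means that $l=0$. If $\operatorname{rank}(\mu G-\nu F)=p$ for all $(\mu,\nu)\ne(0,0)$, then a strictly feasible $X$ exists; for any Kronecker canonical form, this rank condition means that $l=0$ and that the block $\lambda B-A$ is not present ($m=0$). -/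

import Mathlib

namespace PencilFeasibility

open Matrix
open scoped ComplexOrder

/-- The quadratic form `q_M(μ, ν) = [μ; ν]ᴴ M [μ; ν]` of a Hermitian `2 × 2` matrix `M`
(its value is real because `M` is Hermitian). -/
noncomputable def quadForm (M : Matrix (Fin 2) (Fin 2) ℂ) (μ ν : ℂ) : ℝ :=
  (star ![μ, ν] ⬝ᵥ (M *ᵥ ![μ, ν])).re

/-- The set `𝒞` of nonzero pairs with `q_Φ(μ, ν) = 0` and `q_Ψ(μ, ν) ≤ 0`. -/
def curve (Φ Ψ : Matrix (Fin 2) (Fin 2) ℂ) : Set (ℂ × ℂ) :=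
  {x | x ≠ 0 ∧ quadForm Φ x.1 x.2 = 0 ∧ quadForm Ψ x.1 x.2 ≤ 0}

/-- The inequality `q_Ψ ≤ 0` is redundant in the definition of `𝒞` (the case of a line or circle;
its negation is the case of a segment of a line or circle). -/
def IsRedundant (Φ Ψ : Matrix (Fin 2) (Fin 2) ℂ) : Prop :=
  ∀ μ ν : ℂ, (μ, ν) ≠ 0 → quadForm Φ μ ν = 0 → quadForm Ψ μ ν ≤ 0

/-- The set `𝒞°`: equal to `𝒞` in the line or circle case, and to the points of `𝒞` with
`q_Ψ(μ, ν) < 0` in the segment case. -/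
def curveInterior (Φ Ψ : Matrix (Fin 2) (Fin 2) ℂ) : Set (ℂ × ℂ) :=
  {x | x ∈ curve Φ Ψ ∧ (¬ IsRedundant Φ Ψ → quadForm Ψ x.1 x.2 < 0)}

/-- The points of `𝒞` are given in homogeneous coordinates; `𝒞` is neither empty nor a singleton
when it contains two nonproportional pairs. -/
def HasTwoPoints (C : Set (ℂ × ℂ)) : Prop :=
  ∃ x ∈ C, ∃ y ∈ C, x.1 * y.2 ≠ y.1 * x.2

variable {p n : ℕ}

/-- `M₁₁ F X Fᴴ + M₂₁ F X Gᴴ + M₁₂ G X Fᴴ + M₂₂ G X Gᴴ`. -/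
def lmi (M : Matrix (Fin 2) (Fin 2) ℂ) (F G : Matrix (Fin p) (Fin n) ℂ)
    (X : Matrix (Fin n) (Fin n) ℂ) : Matrix (Fin p) (Fin p) ℂ :=
  M 0 0 • (F * X * Fᴴ) + M 1 0 • (F * X * Gᴴ) + M 0 1 • (G * X * Fᴴ) + M 1 1 • (G * X * Gᴴ)

/-- Strict feasibility of `X`: `X ≻ 0`, the equality constraint, and, in the segment case,
the strict matrix inequality `lmi Ψ F G X ≺ 0`. -/
def StrictlyFeasible (Φ Ψ : Matrix (Fin 2) (Fin 2) ℂ) (F G : Matrix (Fin p) (Fin n) ℂ)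
    (X : Matrix (Fin n) (Fin n) ℂ) : Prop :=
  X.PosDef ∧ lmi Φ F G X = 0 ∧ (¬ IsRedundant Φ Ψ → (-lmi Ψ F G X).PosDef)

/-- The normal rank of the pencil `λ G - F`: the largest rank it attains (at most `p`). -/
noncomputable def normalRank (F G : Matrix (Fin p) (Fin n) ℂ) : ℕ :=
  ⨆ z : ℂ, (z • G - F).rank

/-- The `k × (k + 1)` pencil `L_k(z)`, with `z` on the diagonal and `-1` next to it. -/
def blockL (k : ℕ) (z : ℂ) : Matrix (Fin k) (Fin (k + 1)) ℂ :=
  Matrix.of fun i j => if j = i.castSucc then z else if j = i.succ then -1 else 0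

/-- The characteristic polynomial `det (λ B - A)` of a square pencil. -/
noncomputable def pencilDet {m : ℕ} (A B : Matrix (Fin m) (Fin m) ℂ) : Polynomial ℂ :=
  ((Polynomial.X : Polynomial ℂ) • B.map Polynomial.C - A.map Polynomial.C).det

/-- A Kronecker canonical form of the pencil `λ G - F`: nonsingular `P`, `Q` such that
`P (λ G - F) Q` is block diagonal with blocks `L_{η i}(λ)ᵀ` (`i < l`), a regular pencil `λ B - A`
of size `m`, and `L_{ε j}(λ)` (`j < r`). The indices `η i`, `ε j` may be zero. The bijections
`rowEquiv`, `colEquiv` number the rows and the columns of the block matrix. -/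
structure KroneckerForm (F G : Matrix (Fin p) (Fin n) ℂ) where
  l : ℕ
  η : Fin l → ℕ
  m : ℕ
  A : Matrix (Fin m) (Fin m) ℂ
  B : Matrix (Fin m) (Fin m) ℂ
  r : ℕ
  ε : Fin r → ℕ
  P : Matrix (Fin p) (Fin p) ℂ
  Q : Matrix (Fin n) (Fin n) ℂ
  rowEquiv : ((Σ i : Fin l, Fin (η i + 1)) ⊕ (Fin m ⊕ (Σ j : Fin r, Fin (ε j)))) ≃ Fin p
  colEquiv : ((Σ i : Fin l, Fin (η i)) ⊕ (Fin m ⊕ (Σ j : Fin r, Fin (ε j + 1)))) ≃ Fin n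
  isUnit_P : IsUnit P.det
  isUnit_Q : IsUnit Q.det
  regular : pencilDet A B ≠ 0
  eq_blocks : ∀ z : ℂ, P * (z • G - F) * Q = Matrix.reindex rowEquiv colEquiv
    (Matrix.fromBlocks (Matrix.blockDiagonal' fun i => (blockL (η i) z)ᵀ) 0 0
      (Matrix.fromBlocks (z • B - A) 0 0 (Matrix.blockDiagonal' fun j => blockL (ε j) z)))

/-- `z` is a finite generalized eigenvalue of the regular pencil `λ B - A`. -/
def IsFiniteEigenvalue {m : ℕ} (A B : Matrix (Fin m) (Fin m) ℂ) (z : ℂ) : Prop :=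
  (z • B - A).det = 0

/-- The regular pencil `λ B - A` has a generalized eigenvalue at infinity. -/
def IsInfiniteEigenvalue {m : ℕ} (B : Matrix (Fin m) (Fin m) ℂ) : Prop :=
  B.det = 0

/-- For every generalized eigenvalue of the regular pencil `λ B - A`, finite or infinite, the
algebraic multiplicity equals the geometric multiplicity. For a finite eigenvalue `z` these are
the multiplicity of `z` as a root of `det (λ B - A)` and `dim ker (z B - A) = m - rank (z B - A)`;
for the infinite one they are `m - deg det (λ B - A)` and `dim ker B = m - rank B`. -/
def Nondefective {m : ℕ} (A B : Matrix (Fin m) (Fin m) ℂ) : Prop :=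
  (∀ z : ℂ, IsFiniteEigenvalue A B z →
    (pencilDet A B).rootMultiplicity z = m - (z • B - A).rank) ∧
  (IsInfiniteEigenvalue B → m - (pencilDet A B).natDegree = m - B.rank)

/-- All generalized eigenvalues of the regular pencil `λ B - A` lie in `S`, where a finite
eigenvalue `z` is identified with `(z, 1)` and the infinite one with `(1, 0)`. -/
def EigenvaluesIn {m : ℕ} (A B : Matrix (Fin m) (Fin m) ℂ) (S : Set (ℂ × ℂ)) : Prop :=
  (∀ z : ℂ, IsFiniteEigenvalue A B z → (z, 1) ∈ S) ∧
  (IsInfiniteEigenvalue B → ((1, 0) : ℂ × ℂ) ∈ S)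

end PencilFeasibility

/-!
Both directions rest on evaluating the matrix inequalities on eigenvectors of the pencil.

If `y F = a u` and `y G = b u` for row vectors `y ≠ 0` and `u`, then
`y (lmi M F G X) yᴴ = q_M(a, b) · u X uᴴ`. For strictly feasible `X` this places `(a, b)` in `𝒞°`
when `u ≠ 0`, and the same evaluation on a generalized eigenvector of order two contradicts
`det Φ ≠ 0`.

Conversely, if the columns `v i` of `V` satisfy `F v i = a i w i` and `G v i = b i w i`, then
`lmi M F G (V Vᴴ) = ∑ i, q_M(a i, b i) w i (w i)ᴴ`, so it suffices that eigenvectors belonging to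
points of `𝒞°` span `ℂⁿ`. A nondefective regular part is spanned by its eigenvectors, and a block
`L_k` has an eigenvector at every point of the projective line: by Vandermonde, those at `k + 1`
points of an arc of `𝒞°` form a basis.

A Kronecker form of a pencil of full row rank is obtained by splitting off blocks `L_e`: a
polynomial vector `v(λ)` of minimal degree `e` with `(λ G - F) v(λ) = 0` spans such a block, and
minimality yields linear forms whose common kernels are a complement stable under `F` and `G`.
-/

namespace PencilFeasibility

open Matrix Polynomial
open scoped ComplexOrder

/-! ### Hermitian forms on `ℂ²` and the curve -/

section Curve

variable {M Φ Ψ : Matrix (Fin 2) (Fin 2) ℂ} {x y : ℂ × ℂ}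

/-- The sesquilinear form of a `2 × 2` matrix, linear in the first argument; its restriction to
the diagonal is `quadForm`. -/
def sesqForm (M : Matrix (Fin 2) (Fin 2) ℂ) (x y : ℂ × ℂ) : ℂ :=
  M 0 0 * (x.1 * star y.1) + M 1 0 * (x.1 * star y.2) + M 0 1 * (x.2 * star y.1) +
    M 1 1 * (x.2 * star y.2)

theorem star_sesqForm (hM : M.IsHermitian) (x y : ℂ × ℂ) :
    star (sesqForm M x y) = sesqForm M y x := by
  simp only [sesqForm, star_add, star_mul', star_star, hM.apply]
  ring

theorem sesqForm_smul_right (M : Matrix (Fin 2) (Fin 2) ℂ) (c : ℂ) (x y : ℂ × ℂ) :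
    sesqForm M x (c • y) = star c * sesqForm M x y := by
  simp only [sesqForm, Prod.smul_fst, Prod.smul_snd, smul_eq_mul, star_mul']
  ring

theorem gram_sesqForm (M : Matrix (Fin 2) (Fin 2) ℂ) (x y : ℂ × ℂ) :
    sesqForm M x x * sesqForm M y y - sesqForm M x y * sesqForm M y x =
      M.det * ((x.1 * y.2 - y.1 * x.2) * star (x.1 * y.2 - y.1 * x.2)) := by
  simp only [sesqForm, det_fin_two, star_sub, star_mul']
  ring

theorem sesqForm_ne_zero (hM : M.det ≠ 0) (hy : sesqForm M y y = 0)
    (hxy : x.1 * y.2 ≠ y.1 * x.2) : sesqForm M x y ≠ 0 := by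
  intro h
  have hgram := gram_sesqForm M x y
  rw [hy, h, mul_zero, zero_mul, sub_zero, eq_comm] at hgram
  have hwedge := sub_ne_zero.mpr hxy
  exact mul_ne_zero hM (mul_ne_zero hwedge (star_ne_zero.mpr hwedge)) hgram

theorem ofReal_quadForm (hM : M.IsHermitian) (x : ℂ × ℂ) :
    (quadForm M x.1 x.2 : ℂ) = sesqForm M x x := by
  have hform : star ![x.1, x.2] ⬝ᵥ (M *ᵥ ![x.1, x.2]) = sesqForm M x x := by
    simp only [dotProduct, Pi.star_apply, mulVec, Fin.sum_univ_two, cons_val_zero, cons_val_one,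
      sesqForm]
    ring
  rw [quadForm, hform]
  exact Complex.conj_eq_iff_re.mp (star_sesqForm hM x x)

theorem quadForm_smul (hM : M.IsHermitian) (c : ℂ) (x : ℂ × ℂ) :
    quadForm M (c • x).1 (c • x).2 = Complex.normSq c * quadForm M x.1 x.2 := by
  apply Complex.ofReal_injective
  rw [Complex.ofReal_mul, ofReal_quadForm hM, ofReal_quadForm hM, ← Complex.mul_conj]
  simp only [sesqForm, Prod.smul_fst, Prod.smul_snd, smul_eq_mul, star_mul', Complex.star_def]
  ring

theorem quadForm_smul_add_smul (hM : M.IsHermitian) (s t : ℂ) (x y : ℂ × ℂ) :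
    quadForm M (s • x + t • y).1 (s • x + t • y).2 =
      Complex.normSq s * quadForm M x.1 x.2 + Complex.normSq t * quadForm M y.1 y.2 +
        2 * (s * star t * sesqForm M x y).re := by
  have hcross : ((2 * (s * star t * sesqForm M x y).re : ℝ) : ℂ) =
      s * star t * sesqForm M x y + t * star s * sesqForm M y x := by
    rw [← Complex.add_conj, ← star_sesqForm hM x y, map_mul, map_mul]
    simp only [Complex.star_def, Complex.conj_conj]
    ring
  apply Complex.ofReal_injective
  rw [Complex.ofReal_add, Complex.ofReal_add, hcross, Complex.ofReal_mul, Complex.ofReal_mul,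
    ofReal_quadForm hM, ofReal_quadForm hM, ofReal_quadForm hM, ← Complex.mul_conj,
    ← Complex.mul_conj]
  simp only [sesqForm, Prod.fst_add, Prod.snd_add, Prod.smul_fst, Prod.smul_snd, smul_eq_mul,
    star_mul', star_add, Complex.star_def]
  ring

theorem quadForm_add_ofReal_smul (hM : M.IsHermitian) (t : ℝ) (x y : ℂ × ℂ) :
    quadForm M (x + (t : ℂ) • y).1 (x + (t : ℂ) • y).2 =
      quadForm M x.1 x.2 + t ^ 2 * quadForm M y.1 y.2 + 2 * t * (sesqForm M x y).re := by
  have h := quadForm_smul_add_smul hM 1 t x y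
  rw [one_smul] at h
  rw [h, Complex.star_def, Complex.conj_ofReal, one_mul, Complex.re_ofReal_mul,
    Complex.normSq_ofReal, Complex.normSq_one]
  ring

theorem exists_quadForm_ne_zero (hM : M.IsHermitian) (hdet : M.det ≠ 0) :
    ∃ z : ℂ, quadForm M z 1 ≠ 0 := by
  by_contra! hzero
  have hform (z : ℂ) : sesqForm M (z, 1) (z, 1) = 0 := by
    rw [← ofReal_quadForm hM]
    exact_mod_cast hzero z
  have h0 := hform 0
  have h1 := hform 1
  have hneg := hform (-1)
  have hI := hform Complex.I
  simp only [sesqForm, star_zero, star_one, star_neg, Complex.star_def, Complex.conj_I, mul_zero,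
    mul_one, one_mul, zero_add, mul_neg, neg_neg, Complex.I_mul_I] at h0 h1 hneg hI
  have h10 : M 1 0 = 0 := by
    linear_combination (h1 - hneg) / 4 - Complex.I / 2 * (hI - (h1 + hneg) / 2) +
      (M 1 0 - M 0 1) / 2 * Complex.I_sq
  have h00 : M 0 0 = 0 := by linear_combination (h1 + hneg) / 2 - h0
  apply hdet
  rw [det_fin_two, h00, h10]
  ring

theorem smul_mem_curveInterior (hΦ : Φ.IsHermitian) (hΨ : Ψ.IsHermitian) {c : ℂ} (hc : c ≠ 0)
    (hx : x ∈ curveInterior Φ Ψ) : c • x ∈ curveInterior Φ Ψ := by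
  have hpos : 0 < Complex.normSq c := Complex.normSq_pos.mpr hc
  obtain ⟨⟨hx0, hxΦ, hxΨ⟩, hxlt⟩ := hx
  refine ⟨⟨smul_ne_zero hc hx0, ?_, ?_⟩, fun hred => ?_⟩
  · rw [quadForm_smul hΦ, hxΦ, mul_zero]
  · rw [quadForm_smul hΨ]
    exact mul_nonpos_of_nonneg_of_nonpos hpos.le hxΨ
  · rw [quadForm_smul hΨ]
    exact mul_neg_of_pos_of_neg hpos (hxlt hred)

/-- Two nonproportional points `x`, `y` of the curve, scaled so that `q_Φ` vanishes at all the
points `x + t y` with `t` real, and `q_Ψ ≤ 0` at those with `t > 0`. They are the end points of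
an arc of the curve. -/
structure IsArcFrame (Φ Ψ : Matrix (Fin 2) (Fin 2) ℂ) (x y : ℂ × ℂ) : Prop where
  wedge_ne : x.1 * y.2 ≠ y.1 * x.2
  left_mem : x ∈ curve Φ Ψ
  right_mem : y ∈ curve Φ Ψ
  re_sesqForm_eq : (sesqForm Φ x y).re = 0
  re_sesqForm_le : (sesqForm Ψ x y).re ≤ 0

theorem HasTwoPoints.exists_isArcFrame (hΦ : Φ.IsHermitian) (hΨ : Ψ.IsHermitian)
    (hdet : Φ.det ≠ 0) (hC : HasTwoPoints (curve Φ Ψ)) : ∃ x y, IsArcFrame Φ Ψ x y := by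
  obtain ⟨x, hx, y, hy, hxy⟩ := hC
  have hc : sesqForm Φ x y ≠ 0 :=
    sesqForm_ne_zero hdet (by rw [← ofReal_quadForm hΦ, hy.2.1, Complex.ofReal_zero]) hxy
  set c := sesqForm Φ x y
  have hcI : (star (Complex.I * c) * c).re = 0 := by
    simp only [star_mul', Complex.star_def, Complex.conj_I, Complex.mul_re, Complex.mul_im,
      Complex.neg_re, Complex.neg_im, Complex.I_re, Complex.I_im, Complex.conj_re, Complex.conj_im]
    ring
  obtain ⟨κ, hκ, hκΦ, hκΨ⟩ :
      ∃ κ : ℂ, κ ≠ 0 ∧ (star κ * c).re = 0 ∧ (star κ * sesqForm Ψ x y).re ≤ 0 := by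
    have hIc : Complex.I * c ≠ 0 := mul_ne_zero Complex.I_ne_zero hc
    rcases le_total (star (Complex.I * c) * sesqForm Ψ x y).re 0 with hle | hge
    · exact ⟨Complex.I * c, hIc, hcI, hle⟩
    · refine ⟨-(Complex.I * c), neg_ne_zero.mpr hIc, ?_, ?_⟩ <;>
        rw [star_neg, neg_mul, Complex.neg_re]
      · rw [hcI, neg_zero]
      · exact neg_nonpos.mpr hge
  refine ⟨x, κ • y, fun h => hxy (mul_left_cancel₀ hκ ?_), hx, ⟨smul_ne_zero hκ hy.1, ?_, ?_⟩,
    ?_, ?_⟩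
  · simp only [Prod.smul_fst, Prod.smul_snd, smul_eq_mul] at h
    linear_combination h
  · rw [quadForm_smul hΦ, hy.2.1, mul_zero]
  · rw [quadForm_smul hΨ]
    exact mul_nonpos_of_nonneg_of_nonpos (Complex.normSq_nonneg κ) hy.2.2
  · rwa [sesqForm_smul_right]
  · rwa [sesqForm_smul_right]

namespace IsArcFrame

theorem exists_smul_add_smul (h : IsArcFrame Φ Ψ x y) (z : ℂ × ℂ) :
    ∃ s t : ℂ, z = s • x + t • y := by
  have hd := sub_ne_zero.mpr h.wedge_ne
  refine ⟨(z.1 * y.2 - z.2 * y.1) / (x.1 * y.2 - y.1 * x.2),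
    (z.2 * x.1 - z.1 * x.2) / (x.1 * y.2 - y.1 * x.2), ?_⟩
  ext <;>
  · simp only [Prod.fst_add, Prod.snd_add, Prod.smul_fst, Prod.smul_snd, smul_eq_mul]
    rw [div_mul_eq_mul_div, div_mul_eq_mul_div, ← add_div, eq_div_iff hd]
    ring

theorem isRedundant (h : IsArcFrame Φ Ψ x y) (hΦ : Φ.IsHermitian) (hΨ : Ψ.IsHermitian)
    (hdet : Φ.det ≠ 0) (hx : quadForm Ψ x.1 x.2 = 0) (hy : quadForm Ψ y.1 y.2 = 0)
    (hxy : (sesqForm Ψ x y).re = 0) : IsRedundant Φ Ψ := by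
  intro μ ν _ hz
  obtain ⟨s, t, hst⟩ := h.exists_smul_add_smul (μ, ν)
  have hc : sesqForm Φ x y ≠ 0 := sesqForm_ne_zero hdet
    (by rw [← ofReal_quadForm hΦ, h.right_mem.2.1, Complex.ofReal_zero]) h.wedge_ne
  have him : (sesqForm Φ x y).im ≠ 0 := fun him => hc (Complex.ext h.re_sesqForm_eq him)
  -- The zeros of `q_Φ` are the multiples of real combinations of `x` and `y`.
  have hreal : (s * star t).im = 0 := by
    have hcomb := quadForm_smul_add_smul hΦ s t x y
    rw [← hst, hz, h.left_mem.2.1, h.right_mem.2.1, Complex.mul_re, h.re_sesqForm_eq] at hcomb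
    exact (mul_eq_zero.mp (by linarith : (s * star t).im * (sesqForm Φ x y).im = 0)).resolve_right
      him
  have hcomb := quadForm_smul_add_smul hΨ s t x y
  rw [← hst, hx, hy, Complex.mul_re, hreal, hxy] at hcomb
  simp only [mul_zero, zero_mul, sub_zero, add_zero] at hcomb
  exact hcomb.le

theorem add_smul_mem_curveInterior (h : IsArcFrame Φ Ψ x y) (hΦ : Φ.IsHermitian)
    (hΨ : Ψ.IsHermitian) (hdet : Φ.det ≠ 0) {t : ℝ} (ht : 0 < t) :
    x + (t : ℂ) • y ∈ curveInterior Φ Ψ := by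
  have hx := h.left_mem.2.2
  have hy : t ^ 2 * quadForm Ψ y.1 y.2 ≤ 0 :=
    mul_nonpos_of_nonneg_of_nonpos (sq_nonneg t) h.right_mem.2.2
  have hxy : 2 * t * (sesqForm Ψ x y).re ≤ 0 :=
    mul_nonpos_of_nonneg_of_nonpos (by positivity) h.re_sesqForm_le
  refine ⟨⟨fun h0 => h.wedge_ne ?_, ?_, ?_⟩, fun hred => ?_⟩
  · obtain ⟨h1, h2⟩ := Prod.ext_iff.mp h0
    simp only [Prod.fst_add, Prod.snd_add, Prod.smul_fst, Prod.smul_snd, smul_eq_mul,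
      Prod.fst_zero, Prod.snd_zero] at h1 h2
    linear_combination y.2 * h1 - y.1 * h2
  · rw [quadForm_add_ofReal_smul hΦ, h.left_mem.2.1, h.right_mem.2.1, h.re_sesqForm_eq]
    ring
  · rw [quadForm_add_ofReal_smul hΨ]
    linarith
  · rw [quadForm_add_ofReal_smul hΨ]
    refine lt_of_le_of_ne (by linarith) fun h0 => hred ?_
    have hy0 : t ^ 2 * quadForm Ψ y.1 y.2 = 0 := by linarith
    have hxy0 : 2 * t * (sesqForm Ψ x y).re = 0 := by linarith
    exact h.isRedundant hΦ hΨ hdet (by linarith)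
      ((mul_eq_zero.mp hy0).resolve_left (by positivity))
      ((mul_eq_zero.mp hxy0).resolve_left (by positivity))

end IsArcFrame

end Curve

/-! ### Row kernels of matrices and of pencils -/

section RowKernel

variable {𝕜 R l m n o J : Type*} {m' n' : J → Type*}

theorem vecMul_injective_iff_forall [Ring R] [Fintype m] {A : Matrix m n R} :
    Function.Injective A.vecMul ↔ ∀ y, y ᵥ* A = 0 → y = 0 :=
  injective_iff_map_eq_zero A.vecMulLinear

theorem rank_eq_card_iff_vecMul_injective [Field 𝕜] [Fintype m] [Fintype n] {A : Matrix m n 𝕜} :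
    A.rank = Fintype.card m ↔ Function.Injective A.vecMul := by
  rw [vecMul_injective_iff, linearIndependent_iff_card_eq_finrank_span, eq_comm,
    rank_eq_finrank_span_row, Set.finrank]

theorem rank_eq_card_iff_det_ne_zero [Field 𝕜] [Fintype m] [DecidableEq m] {A : Matrix m m 𝕜} :
    A.rank = Fintype.card m ↔ A.det ≠ 0 := by
  rw [rank_eq_card_iff_vecMul_injective, vecMul_injective_iff_isUnit, isUnit_iff_isUnit_det,
    isUnit_iff_ne_zero]

theorem vecMul_fromCols_injective_iff [Ring R] [Fintype m] {A : Matrix m n R}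
    {B : Matrix m o R} :
    Function.Injective (fromCols A B).vecMul ↔ ∀ y, y ᵥ* A = 0 → y ᵥ* B = 0 → y = 0 := by
  rw [vecMul_injective_iff_forall]
  refine forall_congr' fun y => ?_
  rw [vecMul_fromCols, ← Sum.elim_zero_zero, Sum.elim_eq_iff, and_imp]

theorem vecMul_fromBlocks_zero_injective_iff [Ring R] [Fintype l] [Fintype m]
    {A : Matrix l n R} {D : Matrix m o R} :
    Function.Injective (fromBlocks A 0 0 D).vecMul ↔
      Function.Injective A.vecMul ∧ Function.Injective D.vecMul := by
  have hmap : (fromBlocks A 0 0 D).vecMul = (Equiv.sumArrowEquivProdArrow n o R).symm ∘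
      Prod.map A.vecMul D.vecMul ∘ Equiv.sumArrowEquivProdArrow l m R := by
    funext y
    rw [vecMul_fromBlocks]
    simp only [vecMul_zero, add_zero, zero_add]
    rfl
  rw [hmap, Equiv.comp_injective, Equiv.injective_comp, Prod.map_injective]

theorem vecMul_blockDiagonal'_injective_iff [Ring R] [Fintype J] [DecidableEq J]
    [∀ j, Fintype (m' j)] {A : ∀ j, Matrix (m' j) (n' j) R} :
    Function.Injective (blockDiagonal' A).vecMul ↔ ∀ j, Function.Injective (A j).vecMul := by
  have hmap : (blockDiagonal' A).vecMul = (Equiv.piCurry fun j (_ : n' j) => R).symm ∘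
      Pi.map (fun j => (A j).vecMul) ∘ Equiv.piCurry fun j (_ : m' j) => R := by
    funext y ⟨j, a⟩
    simp only [vecMul, dotProduct, Fintype.sum_sigma, blockDiagonal'_apply]
    rw [Finset.sum_eq_single j]
    · simp only [dite_true, cast_eq]
      rfl
    · intro i _ hij
      simp only [dif_neg hij, mul_zero, Finset.sum_const_zero]
    · simp
  rw [hmap, Equiv.comp_injective, Equiv.injective_comp, Pi.map_injective]

theorem exists_eq_smul_and_eq_smul [Field 𝕜] {V : Type*} [AddCommGroup V] [Module 𝕜 V]
    {μ ν : 𝕜} (hμν : (μ, ν) ≠ 0) {a b : V} (h : μ • b = ν • a) :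
    ∃ u, a = μ • u ∧ b = ν • u := by
  by_cases hμ : μ = 0
  · have hν : ν ≠ 0 := fun hν => hμν (by rw [hμ, hν, Prod.mk_zero_zero])
    refine ⟨ν⁻¹ • b, ?_, (smul_inv_smul₀ hν b).symm⟩
    rw [hμ, zero_smul, eq_comm, smul_eq_zero_iff_right hν] at h
    rw [h, hμ, zero_smul]
  · refine ⟨μ⁻¹ • a, (smul_inv_smul₀ hμ a).symm, ?_⟩
    rw [smul_comm, ← h, inv_smul_smul₀ hμ]

theorem normalRank_eq_iff {p n : ℕ} {F G : Matrix (Fin p) (Fin n) ℂ} :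
    normalRank F G = p ↔ ∃ z : ℂ, (z • G - F).rank = p := by
  have hle (z : ℂ) : (z • G - F).rank ≤ p := rank_le_height _
  have hbdd : BddAbove (Set.range fun z : ℂ => (z • G - F).rank) :=
    ⟨p, Set.forall_mem_range.mpr hle⟩
  constructor
  · intro h
    obtain ⟨z, hz⟩ := Nat.sSup_mem (Set.range_nonempty fun z : ℂ => (z • G - F).rank) hbdd
    exact ⟨z, hz.trans h⟩
  · rintro ⟨z, hz⟩
    exact le_antisymm (ciSup_le hle) (hz.ge.trans (le_ciSup hbdd z))

theorem rank_eq_iff_vecMul_injective [Field 𝕜] {p : ℕ} [Fintype n] {A : Matrix (Fin p) n 𝕜} :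
    A.rank = p ↔ Function.Injective A.vecMul := by
  rw [← rank_eq_card_iff_vecMul_injective, Fintype.card_fin]

end RowKernel

/-! ### Necessity -/

section Necessity

variable {p n q m : ℕ} {M Φ Ψ : Matrix (Fin 2) (Fin 2) ℂ} {F G : Matrix (Fin p) (Fin n) ℂ}
  {X : Matrix (Fin n) (Fin n) ℂ}

theorem vecMul_lmi_dotProduct_star {y y' : Fin p → ℂ} {u v w : Fin n → ℂ} {a b c : ℂ × ℂ}
    (hyF : y ᵥ* F = a.1 • u + b.1 • w) (hyG : y ᵥ* G = a.2 • u + b.2 • w)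
    (hy'F : y' ᵥ* F = c.1 • v) (hy'G : y' ᵥ* G = c.2 • v) :
    y ᵥ* lmi M F G X ⬝ᵥ star y' =
      sesqForm M a c * (u ᵥ* X ⬝ᵥ star v) + sesqForm M b c * (w ᵥ* X ⬝ᵥ star v) := by
  have hterm (H K : Matrix (Fin p) (Fin n) ℂ) :
      y ᵥ* (H * X * Kᴴ) ⬝ᵥ star y' = (y ᵥ* H) ᵥ* X ⬝ᵥ star (y' ᵥ* K) := by
    rw [← vecMul_vecMul, ← vecMul_vecMul, star_vecMul, dotProduct_mulVec]
  simp only [lmi, vecMul_add, vecMul_smul, add_dotProduct, smul_dotProduct, hterm, hyF, hyG, hy'F,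
    hy'G, add_vecMul, smul_vecMul, star_smul, dotProduct_smul, smul_eq_mul, sesqForm]
  ring

theorem vecMul_lmi_dotProduct_star_self (hM : M.IsHermitian) {y : Fin p → ℂ} {u : Fin n → ℂ}
    {x : ℂ × ℂ} (hF : y ᵥ* F = x.1 • u) (hG : y ᵥ* G = x.2 • u) :
    y ᵥ* lmi M F G X ⬝ᵥ star y = quadForm M x.1 x.2 * (u ᵥ* X ⬝ᵥ star u) := by
  rw [vecMul_lmi_dotProduct_star (b := 0) (w := 0) (by simpa using hF) (by simpa using hG) hF hG,
    ofReal_quadForm hM, zero_vecMul, zero_dotProduct, mul_zero, add_zero]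

theorem posDef_vecMul_dotProduct_pos {ι : Type*} [Fintype ι] {X : Matrix ι ι ℂ} (hX : X.PosDef)
    {u : ι → ℂ} (hu : u ≠ 0) : 0 < u ᵥ* X ⬝ᵥ star u := by
  have hpos := hX.dotProduct_mulVec_pos (x := star u) (star_ne_zero.mpr hu)
  rwa [star_star, dotProduct_mulVec] at hpos

theorem quadForm_eq_zero_of_lmi_eq_zero (hΦ : Φ.IsHermitian) (hX : X.PosDef)
    (hlmi : lmi Φ F G X = 0) {y : Fin p → ℂ} {u : Fin n → ℂ} (hu : u ≠ 0) {x : ℂ × ℂ}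
    (hF : y ᵥ* F = x.1 • u) (hG : y ᵥ* G = x.2 • u) : quadForm Φ x.1 x.2 = 0 := by
  have heq := vecMul_lmi_dotProduct_star_self hΦ (X := X) hF hG
  rw [hlmi, vecMul_zero, zero_dotProduct, zero_eq_mul, Complex.ofReal_eq_zero] at heq
  exact heq.resolve_right (posDef_vecMul_dotProduct_pos hX hu).ne'

theorem jordanChain_head_eq_zero (hΦ : Φ.IsHermitian) (hdet : Φ.det ≠ 0) (hX : X.PosDef)
    (hlmi : lmi Φ F G X = 0) {y y' : Fin p → ℂ} {u u' : Fin n → ℂ} {x a : ℂ × ℂ}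
    (hF : y ᵥ* F = x.1 • u) (hG : y ᵥ* G = x.2 • u)
    (hF' : y' ᵥ* F = x.1 • u' + a.1 • u) (hG' : y' ᵥ* G = x.2 • u' + a.2 • u)
    (hax : a.1 * x.2 ≠ x.1 * a.2) : u = 0 := by
  by_contra hu
  have hx : sesqForm Φ x x = 0 := by
    rw [← ofReal_quadForm hΦ, quadForm_eq_zero_of_lmi_eq_zero hΦ hX hlmi hu hF hG,
      Complex.ofReal_zero]
  have heq := vecMul_lmi_dotProduct_star (M := Φ) (X := X) hF' hG' hF hG
  rw [hlmi, vecMul_zero, zero_dotProduct, hx, zero_mul, zero_add, zero_eq_mul] at heq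
  exact heq.elim (sesqForm_ne_zero hdet hx hax) (posDef_vecMul_dotProduct_pos hX hu).ne'

namespace StrictlyFeasible

theorem vecMul_fromCols_injective (hX : StrictlyFeasible Φ Ψ F G X)
    (hrow : IsRedundant Φ Ψ → (fromCols F G).rank = p) :
    Function.Injective (fromCols F G).vecMul := by
  by_cases hred : IsRedundant Φ Ψ
  · exact rank_eq_iff_vecMul_injective.mp (hrow hred)
  · refine vecMul_fromCols_injective_iff.mpr fun y hF hG => ?_
    by_contra hy
    have hpos := posDef_vecMul_dotProduct_pos (hX.2.2 hred) hy
    rw [vecMul_neg, neg_dotProduct, vecMul_lmi_dotProduct_star (a := 0) (b := 0) (c := 0)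
      (u := 0) (v := 0) (w := 0) (by simpa using hF) (by simpa using hG) (by simpa using hF)
      (by simpa using hG)] at hpos
    simp at hpos

theorem mem_curveInterior (hΦ : Φ.IsHermitian) (hΨ : Ψ.IsHermitian)
    (hX : StrictlyFeasible Φ Ψ F G X) {y : Fin p → ℂ} {u : Fin n → ℂ} {x : ℂ × ℂ}
    (hF : y ᵥ* F = x.1 • u) (hG : y ᵥ* G = x.2 • u) (hy : y ≠ 0) (hu : u ≠ 0) (hx : x ≠ 0) :
    x ∈ curveInterior Φ Ψ := by
  have hxΦ := quadForm_eq_zero_of_lmi_eq_zero hΦ hX.1 hX.2.1 hu hF hG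
  have hxΨ : ¬ IsRedundant Φ Ψ → quadForm Ψ x.1 x.2 < 0 := by
    intro hred
    have hneg := posDef_vecMul_dotProduct_pos (hX.2.2 hred) hy
    have hpos := posDef_vecMul_dotProduct_pos hX.1 hu
    rw [vecMul_neg, neg_dotProduct, vecMul_lmi_dotProduct_star_self hΨ hF hG, neg_pos] at hneg
    by_contra! hnonneg
    exact hneg.not_ge (mul_nonneg (Complex.zero_le_real.mpr hnonneg) hpos.le)
  refine ⟨⟨hx, hxΦ, ?_⟩, hxΨ⟩
  by_cases hred : IsRedundant Φ Ψ
  · exact hred x.1 x.2 hx hxΦ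
  · exact (hxΨ hred).le

theorem mem_curveInterior_of_vecMul_eq_zero (hΦ : Φ.IsHermitian) (hΨ : Ψ.IsHermitian)
    (hX : StrictlyFeasible Φ Ψ F G X) (hFG : Function.Injective (fromCols F G).vecMul) {μ ν : ℂ}
    (hμν : (μ, ν) ≠ 0) {y : Fin p → ℂ} (hy : y ≠ 0) (h : y ᵥ* (μ • G - ν • F) = 0) :
    (μ, ν) ∈ curveInterior Φ Ψ := by
  rw [vecMul_sub, vecMul_smul, vecMul_smul, sub_eq_zero] at h
  obtain ⟨u, hF, hG⟩ := exists_eq_smul_and_eq_smul hμν h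
  refine hX.mem_curveInterior hΦ hΨ hF hG hy (fun hu => hy ?_) hμν
  exact vecMul_fromCols_injective_iff.mp hFG y (by rw [hF, hu, smul_zero])
    (by rw [hG, hu, smul_zero])

theorem normalRank_eq (hΦ : Φ.IsHermitian) (hΨ : Ψ.IsHermitian) (hdet : Φ.det ≠ 0)
    (hX : StrictlyFeasible Φ Ψ F G X) (hFG : Function.Injective (fromCols F G).vecMul) :
    normalRank F G = p := by
  obtain ⟨z, hz⟩ := exists_quadForm_ne_zero hΦ hdet
  refine normalRank_eq_iff.mpr ⟨z, rank_eq_iff_vecMul_injective.mpr ?_⟩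
  refine vecMul_injective_iff_forall.mpr fun y hy => ?_
  by_contra hy0
  refine hz (hX.mem_curveInterior_of_vecMul_eq_zero hΦ hΨ hFG (by simp) hy0 ?_).1.2.1
  rwa [one_smul]

end StrictlyFeasible

theorem lmi_conj {A B : Matrix (Fin q) (Fin m) ℂ} {R : Matrix (Fin q) (Fin p) ℂ}
    {C : Matrix (Fin m) (Fin n) ℂ} (hF : R * F = A * C) (hG : R * G = B * C) :
    lmi M A B (C * X * Cᴴ) = R * lmi M F G X * Rᴴ := by
  have hterm {H K : Matrix (Fin p) (Fin n) ℂ} {H' K' : Matrix (Fin q) (Fin m) ℂ}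
      (hH : R * H = H' * C) (hK : R * K = K' * C) :
      H' * (C * X * Cᴴ) * K'ᴴ = R * (H * X * Kᴴ) * Rᴴ := by
    calc H' * (C * X * Cᴴ) * K'ᴴ = (H' * C) * X * (K' * C)ᴴ := by
          simp only [conjTranspose_mul, Matrix.mul_assoc]
      _ = R * (H * X * Kᴴ) * Rᴴ := by
          rw [← hH, ← hK]
          simp only [conjTranspose_mul, Matrix.mul_assoc]
  simp only [lmi, hterm hF hF, hterm hF hG, hterm hG hF, hterm hG hG, Matrix.mul_add,
    Matrix.add_mul, Matrix.mul_smul, Matrix.smul_mul]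

theorem StrictlyFeasible.compress {A B : Matrix (Fin q) (Fin m) ℂ}
    {R : Matrix (Fin q) (Fin p) ℂ} {C : Matrix (Fin m) (Fin n) ℂ} (hF : R * F = A * C)
    (hG : R * G = B * C) (hR : Function.Injective R.vecMul) (hC : Function.Injective C.vecMul)
    (hX : StrictlyFeasible Φ Ψ F G X) : StrictlyFeasible Φ Ψ A B (C * X * Cᴴ) := by
  refine ⟨hX.1.mul_mul_conjTranspose_same hC, ?_, fun hred => ?_⟩
  · rw [lmi_conj hF hG, hX.2.1, Matrix.mul_zero, Matrix.zero_mul]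
  · rw [lmi_conj hF hG, ← Matrix.neg_mul, ← Matrix.mul_neg]
    exact (hX.2.2 hred).mul_mul_conjTranspose_same hR

end Necessity

/-! ### Regular pencils -/

section Nondefective

variable {𝕜 ι : Type*} [Field 𝕜] [Fintype ι] [DecidableEq ι] {S : Matrix ι ι 𝕜} {t : 𝕜}

theorem rootMultiplicity_reverse (f : 𝕜[X]) {z : 𝕜} (hz : z ≠ 0) :
    f.reverse.rootMultiplicity z = f.rootMultiplicity z⁻¹ := by
  rcases eq_or_ne f 0 with rfl | hf
  · rw [reverse_zero, rootMultiplicity_zero, rootMultiplicity_zero]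
  obtain ⟨g, hfg, hdvd⟩ := exists_eq_pow_rootMultiplicity_mul_and_not_dvd f hf z⁻¹
  have hg : g ≠ 0 := fun h => hdvd (h ▸ dvd_zero _)
  have hroot : ¬ g.reverse.IsRoot z := by
    let := invertibleOfNonzero (inv_ne_zero hz)
    have hiff := eval₂_reverse_eq_zero_iff (RingHom.id 𝕜) z⁻¹ g
    rw [invOf_eq_inv, inv_inv, ← eval, ← eval] at hiff
    rwa [IsRoot, hiff, ← IsRoot.def, ← dvd_iff_isRoot]
  have hlin : (X - C z⁻¹).reverse = C (-z⁻¹) * (X - C z) := by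
    rw [sub_eq_add_neg, ← C_neg, ← one_mul X, reverse_add_C, reverse_mul_X, ← C_1, reverse_C,
      C_1, one_mul, natDegree_X, pow_one, mul_sub, ← C_mul, neg_mul, inv_mul_cancel₀ hz]
    simp only [C_neg, C_1]
    ring
  have hpow (k : ℕ) : ((X - C z⁻¹) ^ k).reverse = C ((-z⁻¹) ^ k) * (X - C z) ^ k := by
    induction k with
    | zero => rw [pow_zero, pow_zero, pow_zero, mul_one, ← C_1, reverse_C]
    | succ k ih => rw [pow_succ, reverse_mul_of_domain, ih, hlin, pow_succ, pow_succ, C_mul]; ring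
  have hC : (-z⁻¹) ^ f.rootMultiplicity z⁻¹ ≠ 0 := pow_ne_zero _ (neg_ne_zero.mpr (inv_ne_zero hz))
  have hlead := mul_ne_zero (C_ne_zero.mpr hC) (pow_ne_zero (f.rootMultiplicity z⁻¹)
    (X_sub_C_ne_zero z))
  conv_lhs => rw [hfg]
  rw [reverse_mul_of_domain, hpow,
    rootMultiplicity_mul (mul_ne_zero hlead (mt reverse_eq_zero.mp hg)),
    rootMultiplicity_mul hlead, rootMultiplicity_C, rootMultiplicity_X_sub_C_pow,
    rootMultiplicity_eq_zero hroot, zero_add, add_zero]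

/-- All eigenvalues of the matrix `S` have equal algebraic and geometric multiplicities. -/
def IsNondefective (S : Matrix ι ι 𝕜) : Prop :=
  ∀ t : 𝕜, S.charpoly.rootMultiplicity t = Fintype.card ι - (S - t • 1).rank

theorem isNondefective_transpose : IsNondefective Sᵀ ↔ IsNondefective S := by
  refine forall_congr' fun t => ?_
  rw [charpoly_transpose, ← rank_transpose (S - t • 1), transpose_sub, transpose_smul,
    transpose_one]

theorem finrank_eigenspace_toLin' (S : Matrix ι ι 𝕜) (t : 𝕜) :
    Module.finrank 𝕜 (Module.End.eigenspace S.toLin' t) = Fintype.card ι - (S - t • 1).rank := by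
  have hsub : (S - t • (1 : Matrix ι ι 𝕜)).toLin' = S.toLin' - t • 1 := by
    rw [map_sub, map_smul, toLin'_one]
    rfl
  have hnullity := (S - t • (1 : Matrix ι ι 𝕜)).toLin'.finrank_range_add_finrank_ker
  rw [Module.finrank_fintype_fun_eq_card] at hnullity
  rw [Module.End.eigenspace_def, ← hsub, ← hnullity, rank, toLin'_apply', Nat.add_sub_cancel_left]

theorem isNondefective_iff_maxGenEigenspace_eq :
    IsNondefective S ↔
      ∀ t, Module.End.maxGenEigenspace S.toLin' t = Module.End.eigenspace S.toLin' t := by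
  refine forall_congr' fun t => ?_
  rw [← charpoly_toLin', ← LinearMap.finrank_maxGenEigenspace_eq, ← finrank_eigenspace_toLin']
  refine ⟨fun h => ?_, fun h => by rw [h]⟩
  exact (Submodule.eq_of_le_of_finrank_eq Module.End.eigenspace_le_maxGenEigenspace h.symm).symm

theorem isNondefective_of_forall_jordanChain
    (h : ∀ (t : 𝕜) (v w : ι → 𝕜), S *ᵥ v = t • v → S *ᵥ w = t • w + v → v = 0) :
    IsNondefective S := by
  refine isNondefective_iff_maxGenEigenspace_eq.mpr fun t =>
    le_antisymm (fun w hw => ?_) Module.End.eigenspace_le_maxGenEigenspace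
  obtain ⟨k, hk⟩ := (Module.End.mem_maxGenEigenspace _ _ _).mp hw
  clear hw
  induction k generalizing w with
  | zero =>
    rw [pow_zero, Module.End.one_apply] at hk
    exact hk ▸ zero_mem _
  | succ k ih =>
    rw [pow_succ, Module.End.mul_apply] at hk
    have hv := Module.End.mem_eigenspace_iff.mp (ih _ hk)
    have hw : S.toLin' w = t • w + (S.toLin' - t • 1) w := by
      rw [LinearMap.sub_apply, LinearMap.smul_apply, Module.End.one_apply, add_sub_cancel]
    have hv0 := h t _ w hv hw
    rwa [hv0, add_zero, ← Module.End.mem_eigenspace_iff] at hw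

theorem IsNondefective.iSup_eigenspace_eq_top [IsAlgClosed 𝕜] (h : IsNondefective S) :
    ⨆ t, Module.End.eigenspace S.toLin' t = ⊤ := by
  rw [← Module.End.iSup_maxGenEigenspace_eq_top S.toLin']
  exact iSup_congr fun t => (isNondefective_iff_maxGenEigenspace_eq.mp h t).symm

theorem isRoot_charpoly_iff : S.charpoly.IsRoot t ↔ (S - t • 1).det = 0 := by
  rw [IsRoot, eval_charpoly, scalar_apply, ← smul_one_eq_diagonal, ← neg_sub S, det_neg,
    mul_eq_zero, or_iff_right (pow_ne_zero _ (neg_ne_zero.mpr one_ne_zero))]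

theorem eval_charpolyRev_eq_det (S : Matrix ι ι 𝕜) (z : 𝕜) :
    S.charpolyRev.eval z = (1 - z • S).det := by
  rw [charpolyRev, ← coe_evalRingHom, RingHom.map_det, map_sub, map_one]
  congr 2
  ext i j
  simp only [RingHom.mapMatrix_apply, map_apply, Matrix.smul_apply, smul_eq_mul, coe_evalRingHom,
    eval_mul, eval_X, eval_C]

end Nondefective

section RegularPencil

variable {m : ℕ} {A B : Matrix (Fin m) (Fin m) ℂ} {c z : ℂ}

theorem eval_pencilDet (A B : Matrix (Fin m) (Fin m) ℂ) (z : ℂ) :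
    (pencilDet A B).eval z = (z • B - A).det := by
  rw [pencilDet, ← coe_evalRingHom, RingHom.map_det]
  congr 1
  ext i j
  simp only [RingHom.mapMatrix_apply, map_apply, Matrix.sub_apply, Matrix.smul_apply, smul_eq_mul,
    coe_evalRingHom, eval_sub, eval_mul, eval_X, eval_C]

theorem pencilDet_ne_zero_iff : pencilDet A B ≠ 0 ↔ ∃ z : ℂ, (z • B - A).det ≠ 0 := by
  refine ⟨fun h => ?_, fun ⟨z, hz⟩ h => hz (by rw [← eval_pencilDet, h, eval_zero])⟩
  by_contra! hzero
  exact h (funext fun z => by rw [eval_pencilDet, hzero, eval_zero])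

/-- The matrix `B (c B - A)⁻¹` of a regular pencil, taken at some `c` with `det (c B - A) ≠ 0`.
An eigenvalue `z` of the pencil corresponds to the eigenvalue `(c - z)⁻¹` of this matrix, and `∞`
to `0`. -/
noncomputable def shiftInvert (A B : Matrix (Fin m) (Fin m) ℂ) (c : ℂ) :
    Matrix (Fin m) (Fin m) ℂ :=
  B * (c • B - A)⁻¹

theorem shiftInvert_mul (hc : (c • B - A).det ≠ 0) : shiftInvert A B c * (c • B - A) = B := by
  rw [shiftInvert, Matrix.mul_assoc, nonsing_inv_mul _ hc.isUnit, Matrix.mul_one]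

theorem smul_sub_eq_mul_pencil (hc : (c • B - A).det ≠ 0) (z : ℂ) :
    z • B - A = (1 - (c - z) • shiftInvert A B c) * (c • B - A) := by
  rw [Matrix.sub_mul, Matrix.one_mul, Matrix.smul_mul, shiftInvert_mul hc]
  module

theorem pencilDet_eq (hc : (c • B - A).det ≠ 0) :
    pencilDet A B =
      C (c • B - A).det * (shiftInvert A B c).charpoly.reverse.comp (C (-1) * X + C c) := by
  refine funext fun z => ?_
  rw [eval_pencilDet, smul_sub_eq_mul_pencil hc z, det_mul, reverse_charpoly, eval_mul, eval_C,
    eval_comp, eval_charpolyRev_eq_det, mul_comm, eval_add, eval_mul, eval_C, eval_C, eval_X,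
    neg_one_mul, neg_add_eq_sub]

theorem rootMultiplicity_pencilDet (hc : (c • B - A).det ≠ 0) (hz : z ≠ c) :
    (pencilDet A B).rootMultiplicity z =
      (shiftInvert A B c).charpoly.rootMultiplicity (c - z)⁻¹ := by
  have hne : pencilDet A B ≠ 0 := pencilDet_ne_zero_iff.mpr ⟨c, hc⟩
  rw [pencilDet_eq hc] at hne ⊢
  rw [rootMultiplicity_mul hne, rootMultiplicity_C, zero_add,
    rootMultiplicity_comp_C_mul_X_add_C _ _ _ _ isUnit_neg_one, neg_one_mul, neg_add_eq_sub,
    rootMultiplicity_reverse _ (sub_ne_zero.mpr hz.symm)]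

theorem sub_natDegree_pencilDet (hc : (c • B - A).det ≠ 0) :
    m - (pencilDet A B).natDegree = (shiftInvert A B c).charpoly.rootMultiplicity 0 := by
  have hdeg : (shiftInvert A B c).charpoly.natDegree = m := by
    rw [charpoly_natDegree_eq_dim, Fintype.card_fin]
  have hle := (shiftInvert A B c).charpoly.natTrailingDegree_le_natDegree
  rw [hdeg] at hle
  rw [pencilDet_eq hc, natDegree_C_mul hc, natDegree_comp,
    natDegree_linear (neg_ne_zero.mpr one_ne_zero), mul_one, reverse_natDegree, hdeg,
    rootMultiplicity_eq_natTrailingDegree', Nat.sub_sub_self hle]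

theorem rank_smul_sub (hc : (c • B - A).det ≠ 0) (hz : z ≠ c) :
    (z • B - A).rank = (shiftInvert A B c - (c - z)⁻¹ • 1).rank := by
  have hcz : c - z ≠ 0 := sub_ne_zero.mpr hz.symm
  have hfactor : 1 - (c - z) • shiftInvert A B c =
      (-(c - z)) • (shiftInvert A B c - (c - z)⁻¹ • 1) := by
    rw [smul_sub, smul_smul, neg_mul, mul_inv_cancel₀ hcz]
    module
  rw [smul_sub_eq_mul_pencil hc z, rank_mul_eq_left_of_isUnit_det _ _ hc.isUnit, hfactor,
    rank_smul_of_mem_nonZeroDivisors _ (mem_nonZeroDivisors_of_ne_zero (neg_ne_zero.mpr hcz))]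

theorem rank_eq_rank_shiftInvert (hc : (c • B - A).det ≠ 0) :
    B.rank = (shiftInvert A B c - (0 : ℂ) • 1).rank := by
  rw [zero_smul, sub_zero, shiftInvert,
    rank_mul_eq_left_of_isUnit_det _ _ (isUnit_nonsing_inv_det_iff.mpr hc.isUnit)]

theorem nondefective_iff_isNondefective (hc : (c • B - A).det ≠ 0) :
    Nondefective A B ↔ IsNondefective (shiftInvert A B c) := by
  refine ⟨fun ⟨hfin, hinf⟩ t => ?_, fun h => ⟨fun z hz => ?_, fun _ => ?_⟩⟩
  · by_cases hroot : (shiftInvert A B c).charpoly.IsRoot t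
    swap
    · rw [rootMultiplicity_eq_zero hroot,
        rank_eq_card_iff_det_ne_zero.mpr (mt isRoot_charpoly_iff.mpr hroot), Nat.sub_self]
    have hrank := mt rank_eq_card_iff_det_ne_zero.mp
      (not_not_intro (isRoot_charpoly_iff.mp hroot))
    rw [Fintype.card_fin] at hrank ⊢
    rcases eq_or_ne t 0 with rfl | ht
    · rw [← rank_eq_rank_shiftInvert hc] at hrank ⊢
      rw [← sub_natDegree_pencilDet hc]
      exact hinf (by_contra fun hdet =>
        hrank ((rank_of_det_ne_zero hdet).trans (Fintype.card_fin m)))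
    · obtain ⟨z, hz, rfl⟩ : ∃ z, z ≠ c ∧ (c - z)⁻¹ = t :=
        ⟨c - t⁻¹, by simpa using ht, by rw [sub_sub_cancel, inv_inv]⟩
      rw [← rank_smul_sub hc hz] at hrank ⊢
      rw [← rootMultiplicity_pencilDet hc hz]
      exact hfin z (by_contra fun hdet =>
        hrank ((rank_of_det_ne_zero hdet).trans (Fintype.card_fin m)))
  · have hzc : z ≠ c := by rintro rfl; exact hc hz
    rw [rootMultiplicity_pencilDet hc hzc, rank_smul_sub hc hzc, h, Fintype.card_fin]
  · rw [sub_natDegree_pencilDet hc, rank_eq_rank_shiftInvert hc, h, Fintype.card_fin]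

end RegularPencil

/-! ### Eigenvalues of regular pencils -/

section Eigenvalues

variable {m : ℕ} {Φ Ψ : Matrix (Fin 2) (Fin 2) ℂ} {A B : Matrix (Fin m) (Fin m) ℂ}
  {X : Matrix (Fin m) (Fin m) ℂ} {S : Set (ℂ × ℂ)} {c : ℂ}

theorem EigenvaluesIn.of_forall
    (h : ∀ μ ν : ℂ, (μ, ν) ≠ 0 → (μ • B - ν • A).det = 0 → (μ, ν) ∈ S) : EigenvaluesIn A B S := by
  refine ⟨fun z hz => h z 1 (by simp) ?_, fun hB => h 1 0 (by simp) ?_⟩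
  · rwa [one_smul]
  · rwa [one_smul, zero_smul, sub_zero]

theorem EigenvaluesIn.mem_curveInterior (hΦ : Φ.IsHermitian) (hΨ : Ψ.IsHermitian)
    (h : EigenvaluesIn A B (curveInterior Φ Ψ)) {μ ν : ℂ} (hμν : (μ, ν) ≠ 0)
    (hdet : (μ • B - ν • A).det = 0) : (μ, ν) ∈ curveInterior Φ Ψ := by
  by_cases hν : ν = 0
  · have hμ : μ ≠ 0 := fun hμ => hμν (by rw [hμ, hν, Prod.mk_zero_zero])
    rw [hν, zero_smul, sub_zero, det_smul, mul_eq_zero, or_iff_right (pow_ne_zero _ hμ)] at hdet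
    have hmem := smul_mem_curveInterior hΦ hΨ hμ (h.2 hdet)
    rwa [Prod.smul_mk, smul_eq_mul, smul_eq_mul, mul_one, mul_zero, ← hν] at hmem
  · have hpencil : μ • B - ν • A = ν • ((μ / ν) • B - A) := by
      rw [smul_sub, smul_smul, mul_div_cancel₀ _ hν]
    rw [hpencil, det_smul, mul_eq_zero, or_iff_right (pow_ne_zero _ hν)] at hdet
    have hmem := smul_mem_curveInterior hΦ hΨ hν (h.1 _ hdet)
    rwa [Prod.smul_mk, smul_eq_mul, smul_eq_mul, mul_one, mul_div_cancel₀ _ hν] at hmem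

theorem vecMul_fromCols_injective_of_det_ne_zero (hc : (c • B - A).det ≠ 0) :
    Function.Injective (fromCols A B).vecMul := by
  refine vecMul_fromCols_injective_iff.mpr fun y hA hB => eq_zero_of_vecMul_eq_zero hc ?_
  rw [vecMul_sub, vecMul_smul, hA, hB, smul_zero, sub_zero]

namespace StrictlyFeasible

theorem eigenvaluesIn (hΦ : Φ.IsHermitian) (hΨ : Ψ.IsHermitian)
    (hX : StrictlyFeasible Φ Ψ A B X) (hc : (c • B - A).det ≠ 0) :
    EigenvaluesIn A B (curveInterior Φ Ψ) := by
  refine EigenvaluesIn.of_forall fun μ ν hμν hdet => ?_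
  obtain ⟨y, hy, hyAB⟩ := exists_vecMul_eq_zero_iff.mpr hdet
  exact hX.mem_curveInterior_of_vecMul_eq_zero hΦ hΨ (vecMul_fromCols_injective_of_det_ne_zero hc)
    hμν hy hyAB

theorem nondefective (hΦ : Φ.IsHermitian) (hdet : Φ.det ≠ 0)
    (hX : StrictlyFeasible Φ Ψ A B X) (hc : (c • B - A).det ≠ 0) : Nondefective A B := by
  set N := c • B - A with hN
  rw [nondefective_iff_isNondefective hc, ← isNondefective_transpose]
  refine isNondefective_of_forall_jordanChain fun t v w hv hw => ?_
  rw [mulVec_transpose] at hv hw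
  have hSB (y : Fin m → ℂ) : y ᵥ* B = (y ᵥ* shiftInvert A B c) ᵥ* N := by
    rw [vecMul_vecMul, shiftInvert_mul hc]
  have hSA (y : Fin m → ℂ) : y ᵥ* A = c • (y ᵥ* B) - y ᵥ* N := by
    rw [hN, vecMul_sub, vecMul_smul, sub_sub_cancel]
  have hvB : v ᵥ* B = t • (v ᵥ* N) := by rw [hSB, hv, smul_vecMul]
  have hwB : w ᵥ* B = t • (w ᵥ* N) + (1 : ℂ) • (v ᵥ* N) := by
    rw [hSB, hw, add_vecMul, smul_vecMul, one_smul]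
  refine eq_zero_of_vecMul_eq_zero hc (jordanChain_head_eq_zero hΦ hdet hX.1 hX.2.1
    (x := (c * t - 1, t)) (a := (c, 1)) ?_ hvB ?_ hwB ?_)
  · rw [hSA, hvB]
    module
  · rw [hSA, hwB]
    module
  · rw [mul_one, ne_eq, eq_sub_iff_add_eq, add_eq_left]
    exact one_ne_zero

end StrictlyFeasible

theorem exists_det_eq_zero_of_pos (hm : 0 < m) (A B : Matrix (Fin m) (Fin m) ℂ) :
    ∃ μ ν : ℂ, (μ, ν) ≠ 0 ∧ (μ • B - ν • A).det = 0 := by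
  by_cases hB : B.det = 0
  · exact ⟨1, 0, by simp, by rwa [one_smul, zero_smul, sub_zero]⟩
  have : Nonempty (Fin m) := Fin.pos_iff_nonempty.mp hm
  obtain ⟨t, ht⟩ := spectrum.nonempty_of_isAlgClosed_of_finiteDimensional ℂ (A * B⁻¹)
  refine ⟨t, 1, by simp, ?_⟩
  have hpencil : t • B - (1 : ℂ) • A = (algebraMap ℂ _ t - A * B⁻¹) * B := by
    rw [Matrix.sub_mul, Matrix.mul_assoc, nonsing_inv_mul _ (Ne.isUnit hB), Matrix.mul_one,
      ← Algebra.smul_def, one_smul]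
  rw [spectrum.mem_iff, isUnit_iff_isUnit_det, isUnit_iff_ne_zero, not_not] at ht
  rw [hpencil, det_mul, ht, zero_mul]

end Eigenvalues

/-! ### Sufficiency -/

section Sufficiency

variable {p n : ℕ} {ι κ : Type*} {M Φ Ψ : Matrix (Fin 2) (Fin 2) ℂ}
  {F G : Matrix (Fin p) (Fin n) ℂ} {V : Matrix (Fin n) ι ℂ} {W : Matrix (Fin p) ι ℂ}
  {μ ν : ι → ℂ}

theorem lmi_diagonal [Fintype ι] [DecidableEq ι] (hM : M.IsHermitian)
    (hF : F * V = W * diagonal μ) (hG : G * V = W * diagonal ν) :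
    lmi M F G (V * Vᴴ) = W * diagonal (fun i => (quadForm M (μ i) (ν i) : ℂ)) * Wᴴ := by
  have hterm {H K : Matrix (Fin p) (Fin n) ℂ} {a b : ι → ℂ} (hH : H * V = W * diagonal a)
      (hK : K * V = W * diagonal b) :
      H * (V * Vᴴ) * Kᴴ = W * diagonal (a * star b) * Wᴴ := by
    calc H * (V * Vᴴ) * Kᴴ = (H * V) * (K * V)ᴴ := by
          simp only [conjTranspose_mul, Matrix.mul_assoc]
      _ = W * (diagonal a * diagonal (star b)) * Wᴴ := by
          rw [hH, hK, conjTranspose_mul, diagonal_conjTranspose]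
          simp only [Matrix.mul_assoc]
      _ = W * diagonal (a * star b) * Wᴴ := by
          rw [diagonal_mul_diagonal]
          rfl
  rw [lmi, hterm hF hF, hterm hF hG, hterm hG hF, hterm hG hG]
  simp only [← Matrix.smul_mul, ← Matrix.add_mul]
  congr 1
  ext i j
  simp only [Matrix.add_apply, Matrix.smul_apply, mul_diagonal, smul_eq_mul,
    ofReal_quadForm hM (μ j, ν j), sesqForm, Pi.mul_apply, Pi.star_apply]
  ring

theorem StrictlyFeasible.mul_conjTranspose [Fintype ι] [DecidableEq ι] (hΦ : Φ.IsHermitian)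
    (hΨ : Ψ.IsHermitian) (hF : F * V = W * diagonal μ) (hG : G * V = W * diagonal ν)
    (hV : Function.Injective V.vecMul) (hW : Function.Injective W.vecMul)
    (hμν : ∀ i, (μ i, ν i) ∈ curveInterior Φ Ψ) : StrictlyFeasible Φ Ψ F G (V * Vᴴ) := by
  refine ⟨PosDef.mul_conjTranspose_self V hV, ?_, fun hred => ?_⟩
  · have hzero (i : ι) : quadForm Φ (μ i) (ν i) = 0 := (hμν i).1.2.1
    simp only [lmi_diagonal hΦ hF hG, hzero, Complex.ofReal_zero, diagonal_zero, Matrix.mul_zero,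
      Matrix.zero_mul]
  · rw [lmi_diagonal hΨ hF hG, ← Matrix.neg_mul, ← Matrix.mul_neg, diagonal_neg]
    refine (PosDef.diagonal fun i => ?_).mul_mul_conjTranspose_same hW
    rw [← Complex.ofReal_neg]
    exact Complex.zero_lt_real.mpr (neg_pos.mpr ((hμν i).2 hred))

theorem vecMul_injective_of_span_range_col_eq_top {𝕜 : Type*} [CommRing 𝕜] [Finite ι]
    [Fintype κ] {V : Matrix κ ι 𝕜} (hV : Submodule.span 𝕜 (Set.range V.col) = ⊤) :
    Function.Injective V.vecMul := by
  classical
  cases nonempty_fintype ι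
  rw [← range_mulVecLin, LinearMap.range_eq_top] at hV
  obtain ⟨R, hR⟩ := mulVec_surjective_iff_exists_right_inverse.mp hV
  refine vecMul_injective_iff_forall.mpr fun y hy => ?_
  rw [← vecMul_one y, ← hR, ← vecMul_vecMul, hy, zero_vecMul]

/-- The eigenvectors, with eigenvalues in `S`, of a homogeneous pencil such as
`T μ ν = μ G - ν F`: the vectors `v` for which all the `T μ ν v` are multiples of one vector `w`,
with a coefficient that vanishes at a point of `S`. -/
def pencilEigenvectors [Fintype κ] (T : ℂ → ℂ → Matrix ι κ ℂ) (S : Set (ℂ × ℂ)) : Set (κ → ℂ) :=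
  {v | ∃ x ∈ S, ∃ w : ι → ℂ, ∀ μ ν : ℂ, T μ ν *ᵥ v = (μ * x.2 - ν * x.1) • w}

theorem exists_strictlyFeasible (hΦ : Φ.IsHermitian) (hΨ : Ψ.IsHermitian)
    (hrank : normalRank F G = p)
    (hspan : Submodule.span ℂ
      (pencilEigenvectors (fun μ ν => μ • G - ν • F) (curveInterior Φ Ψ)) = ⊤) :
    ∃ X, StrictlyFeasible Φ Ψ F G X := by
  obtain ⟨k, v, hv, hv_span⟩ : ∃ (k : ℕ) (v : Fin k → Fin n → ℂ),
      (∀ i, v i ∈ pencilEigenvectors (fun μ ν => μ • G - ν • F) (curveInterior Φ Ψ)) ∧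
        Submodule.span ℂ (Set.range v) = ⊤ := by
    obtain ⟨v, hv, hv_span, -⟩ := Submodule.exists_fun_fin_finrank_span_eq ℂ
      (pencilEigenvectors (fun μ ν => μ • G - ν • F) (curveInterior Φ Ψ))
    exact ⟨_, v, hv, hv_span.trans hspan⟩
  choose x hx w hw using hv
  set V := (of v)ᵀ
  set W := (of w)ᵀ
  have hcol (μ ν : ℂ) :
      (μ • G - ν • F) * V = W * diagonal fun i => μ * (x i).2 - ν * (x i).1 := by
    ext a i
    rw [mul_diagonal, mul_comm]
    exact congrFun (hw i μ ν) a
  have hF : F * V = W * diagonal fun i => (x i).1 := by simpa using hcol 0 (-1)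
  have hG : G * V = W * diagonal fun i => (x i).2 := by simpa using hcol 1 0
  have hVinj : Function.Injective V.vecMul :=
    vecMul_injective_of_span_range_col_eq_top hv_span
  obtain ⟨z, hz⟩ := normalRank_eq_iff.mp hrank
  have hWinj : Function.Injective W.vecMul := by
    refine vecMul_injective_iff_forall.mpr fun y hy => ?_
    have hyz : (y ᵥ* (z • G - F)) ᵥ* V = 0 := by
      rw [vecMul_vecMul, ← one_smul ℂ F, hcol, ← vecMul_vecMul, hy, zero_vecMul]
    exact vecMul_injective_iff_forall.mp (rank_eq_iff_vecMul_injective.mp hz) y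
      (vecMul_injective_iff_forall.mp hVinj _ hyz)
  exact ⟨V * Vᴴ, .mul_conjTranspose hΦ hΨ hF hG hVinj hWinj hx⟩

end Sufficiency

section SpanEigenvectors

variable {ι κ ι' κ' : Type*} [Fintype κ] [Fintype κ'] {T : ℂ → ℂ → Matrix ι κ ℂ}
  {T' : ℂ → ℂ → Matrix ι' κ' ℂ} {S : Set (ℂ × ℂ)}

theorem mulVec_mem_span_pencilEigenvectors [Fintype ι] {L : Matrix κ' κ ℂ} {L' : Matrix ι' ι ℂ}
    (hL : ∀ μ ν, T' μ ν * L = L' * T μ ν)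
    (hT : Submodule.span ℂ (pencilEigenvectors T S) = ⊤) (v : κ → ℂ) :
    L *ᵥ v ∈ Submodule.span ℂ (pencilEigenvectors T' S) := by
  have hmaps : L.mulVecLin '' pencilEigenvectors T S ⊆ pencilEigenvectors T' S := by
    rintro _ ⟨v, ⟨x, hx, w, hw⟩, rfl⟩
    refine ⟨x, hx, L' *ᵥ w, fun μ ν => ?_⟩
    rw [mulVecLin_apply, mulVec_mulVec, hL, ← mulVec_mulVec, hw, mulVec_smul]
  have hle := Submodule.span_mono (R := ℂ) hmaps
  rw [Submodule.span_image, hT] at hle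
  exact hle (Submodule.mem_map_of_mem Submodule.mem_top)

theorem single_mem_span_pencilEigenvectors [Finite ι] [DecidableEq κ'] {e : ι → ι'} {f : κ → κ'}
    (he : Function.Injective e) (hsub : ∀ μ ν a b, T' μ ν (e a) (f b) = T μ ν a b)
    (hzero : ∀ μ ν, ∀ i ∉ Set.range e, ∀ b, T' μ ν i (f b) = 0)
    (hT : Submodule.span ℂ (pencilEigenvectors T S) = ⊤) (b : κ) :
    Pi.single (f b) 1 ∈ Submodule.span ℂ (pencilEigenvectors T' S) := by
  classical
  cases nonempty_fintype ι
  have hmem := mulVec_mem_span_pencilEigenvectors (T' := T')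
    (L := (1 : Matrix κ' κ' ℂ).submatrix id f) (L' := (1 : Matrix ι' ι' ℂ).submatrix id e)
    (fun μ ν => ?_) hT (Pi.single b 1)
  · rw [mulVec_single_one] at hmem
    convert hmem using 1
    ext i
    rw [Pi.single_apply, col_apply, submatrix_apply, one_apply, id]
  · ext i b
    simp only [mul_apply, submatrix_apply, id, one_apply, mul_ite, mul_one, mul_zero,
      Finset.sum_ite_eq', Finset.mem_univ, if_true]
    by_cases hi : i ∈ Set.range e
    · obtain ⟨a, rfl⟩ := hi
      simp [he.eq_iff, hsub]
    · rw [hzero μ ν i hi, eq_comm]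
      refine Finset.sum_eq_zero fun a _ => ?_
      rw [if_neg fun h => hi ⟨a, h.symm⟩, zero_mul]

end SpanEigenvectors

section RegularEigenvectors

variable {m : ℕ} {A B : Matrix (Fin m) (Fin m) ℂ} {S : Set (ℂ × ℂ)} {c : ℂ}

theorem inv_mulVec_mem_pencilEigenvectors (hc : (c • B - A).det ≠ 0)
    (hS : ∀ μ ν : ℂ, (μ, ν) ≠ 0 → (μ • B - ν • A).det = 0 → (μ, ν) ∈ S) {t : ℂ} {v : Fin m → ℂ}
    (hv : v ≠ 0) (hvt : shiftInvert A B c *ᵥ v = t • v) :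
    (c • B - A)⁻¹ *ᵥ v ∈ pencilEigenvectors (fun μ ν => μ • B - ν • A) S := by
  set u := (c • B - A)⁻¹ *ᵥ v with hu
  have huv : (c • B - A) *ᵥ u = v := by
    rw [hu, mulVec_mulVec, mul_nonsing_inv _ hc.isUnit, one_mulVec]
  have huB : B *ᵥ u = t • v := by
    rw [hu, mulVec_mulVec, ← shiftInvert, hvt]
  have huA : A *ᵥ u = (c * t - 1) • v := by
    rw [sub_mulVec, smul_mulVec, huB] at huv
    rw [sub_smul, mul_smul, one_smul]
    exact eq_sub_of_add_eq' (sub_eq_iff_eq_add.mp huv).symm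
  have hmul (μ ν : ℂ) : (μ • B - ν • A) *ᵥ u = (μ * t - ν * (c * t - 1)) • v := by
    rw [sub_mulVec, smul_mulVec, smul_mulVec, huA, huB]
    module
  have hu0 : u ≠ 0 := fun h0 => hv (by rw [← huv, h0, mulVec_zero])
  refine ⟨(c * t - 1, t), hS _ _ (fun h0 => ?_) ?_, v, hmul⟩
  · obtain ⟨h1, rfl⟩ := Prod.mk.inj h0
    simp at h1
  · exact exists_mulVec_eq_zero_iff.mp ⟨u, hu0, by rw [hmul, mul_comm, sub_self, zero_smul]⟩

theorem span_pencilEigenvectors_of_nondefective (hc : (c • B - A).det ≠ 0)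
    (hnd : Nondefective A B)
    (hS : ∀ μ ν : ℂ, (μ, ν) ≠ 0 → (μ • B - ν • A).det = 0 → (μ, ν) ∈ S) :
    Submodule.span ℂ (pencilEigenvectors (fun μ ν => μ • B - ν • A) S) = ⊤ := by
  have hinv (v : Fin m → ℂ) : (c • B - A)⁻¹ *ᵥ v ∈
      Submodule.span ℂ (pencilEigenvectors (fun μ ν => μ • B - ν • A) S) := by
    have htop := ((nondefective_iff_isNondefective hc).mp hnd).iSup_eigenspace_eq_top
    induction htop ▸ Submodule.mem_top (x := v) using Submodule.iSup_induction' with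
    | mem t v hv =>
      rcases eq_or_ne v 0 with rfl | hv0
      · rw [mulVec_zero]
        exact zero_mem _
      · exact Submodule.subset_span (inv_mulVec_mem_pencilEigenvectors hc hS hv0
          (Module.End.mem_eigenspace_iff.mp hv))
    | zero =>
      rw [mulVec_zero]
      exact zero_mem _
    | add v w _ _ hv hw =>
      rw [mulVec_add]
      exact add_mem hv hw
  refine Submodule.eq_top_iff'.mpr fun u => ?_
  rw [← one_mulVec u, ← nonsing_inv_mul _ hc.isUnit, ← mulVec_mulVec]
  exact hinv _

end RegularEigenvectors

section SingularBlock

variable {𝕜 : Type*} {k : ℕ}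

/-- The homogeneous version `μ [I 0] - ν [0 I]` of `blockL`, which is its value at `ν = 1`. -/
def homBlockL [Ring 𝕜] (k : ℕ) (μ ν : 𝕜) : Matrix (Fin k) (Fin (k + 1)) 𝕜 :=
  of fun i j => if j = i.castSucc then μ else if j = i.succ then -ν else 0

theorem homBlockL_eq_smul_add_smul [Ring 𝕜] (k : ℕ) (μ ν : 𝕜) :
    homBlockL k μ ν = μ • homBlockL k 1 0 + ν • homBlockL k 0 1 := by
  ext i j
  simp only [homBlockL, of_apply, Matrix.add_apply, Matrix.smul_apply, smul_eq_mul]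
  split_ifs <;> simp

theorem homBlockL_mulVec [Ring 𝕜] (μ ν : 𝕜) (v : Fin (k + 1) → 𝕜) (i : Fin k) :
    (homBlockL k μ ν *ᵥ v) i = μ * v i.castSucc - ν * v i.succ := by
  have hne : i.castSucc ≠ i.succ := Fin.castSucc_lt_succ.ne
  rw [mulVec, dotProduct, Fintype.sum_eq_add i.castSucc i.succ hne]
  · simp [homBlockL, hne.symm, sub_eq_add_neg]
  · rintro x ⟨h1, h2⟩
    simp [homBlockL, h1, h2]

theorem vecMul_homBlockL_injective [Field 𝕜] {μ ν : 𝕜} (hμν : (μ, ν) ≠ 0) :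
    Function.Injective (homBlockL k μ ν).vecMul := by
  refine vecMul_injective_iff_forall.mpr fun y hy => ?_
  have hsub (e : Fin k → Fin (k + 1)) : y ᵥ* (homBlockL k μ ν).submatrix id e = 0 :=
    funext fun j => congrFun hy (e j)
  by_cases hμ : μ = 0
  · have hν : ν ≠ 0 := fun hν => hμν (by rw [hμ, hν, Prod.mk_zero_zero])
    have hdiag : (homBlockL k μ ν).submatrix id Fin.succ = diagonal fun _ => -ν := by
      ext i j
      rcases eq_or_ne i j with rfl | hij
      · simp [homBlockL, Fin.castSucc_lt_succ.ne']
      · simp [homBlockL, hμ, hij, hij.symm]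
    refine eq_zero_of_vecMul_eq_zero ?_ (hsub Fin.succ)
    rw [hdiag, det_diagonal]
    exact Finset.prod_ne_zero_iff.mpr fun _ _ => neg_ne_zero.mpr hν
  · have htriangular : ((homBlockL k μ ν).submatrix id Fin.castSucc).IsUpperTriangular := by
      intro i j hji
      have hlt : j.castSucc < i.castSucc := hji
      simp [homBlockL, hlt.ne, (hlt.trans Fin.castSucc_lt_succ).ne]
    refine eq_zero_of_vecMul_eq_zero ?_ (hsub Fin.castSucc)
    rw [det_of_isUpperTriangular htriangular]
    exact Finset.prod_ne_zero_iff.mpr fun i _ => by simpa [homBlockL] using hμ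

theorem not_vecMul_transpose_homBlockL_injective [Field 𝕜] (μ ν : 𝕜) :
    ¬ Function.Injective (homBlockL k μ ν)ᵀ.vecMul := by
  intro h
  have hrank := rank_le_card_width (homBlockL k μ ν)ᵀ
  rw [rank_eq_card_iff_vecMul_injective.mpr h, Fintype.card_fin, Fintype.card_fin] at hrank
  exact Nat.not_succ_le_self k hrank

theorem IsArcFrame.span_pencilEigenvectors_homBlockL {Φ Ψ : Matrix (Fin 2) (Fin 2) ℂ}
    {x y : ℂ × ℂ} (h : IsArcFrame Φ Ψ x y) (hΦ : Φ.IsHermitian) (hΨ : Ψ.IsHermitian)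
    (hdet : Φ.det ≠ 0) (k : ℕ) :
    Submodule.span ℂ (pencilEigenvectors (homBlockL k) (curveInterior Φ Ψ)) = ⊤ := by
  set z : Fin (k + 1) → ℂ × ℂ := fun i => x + (((i : ℕ) + 1 : ℝ) : ℂ) • y with hz
  have hmem (i : Fin (k + 1)) : z i ∈ curveInterior Φ Ψ :=
    h.add_smul_mem_curveInterior hΦ hΨ hdet (by positivity)
  set Z := projVandermonde (fun i => (z i).1) (fun i => (z i).2) with hZ
  have hZdet : Z.det ≠ 0 := by
    rw [hZ, det_projVandermonde]
    refine Finset.prod_ne_zero_iff.mpr fun i _ => Finset.prod_ne_zero_iff.mpr fun j hj => ?_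
    have hij : ((i : ℕ) : ℂ) ≠ (j : ℕ) :=
      Nat.cast_injective.ne (Fin.val_ne_of_ne (Finset.mem_Ioi.mp hj).ne)
    have hwedge : (z j).1 * (z i).2 - (z i).1 * (z j).2 =
        ((i : ℕ) - (j : ℕ) : ℂ) * (x.1 * y.2 - y.1 * x.2) := by
      simp only [hz, Prod.fst_add, Prod.snd_add, Prod.smul_fst, Prod.smul_snd, smul_eq_mul]
      push_cast
      ring
    rw [hwedge]
    exact mul_ne_zero (sub_ne_zero.mpr hij) (sub_ne_zero.mpr h.wedge_ne)
  have hrow (i : Fin (k + 1)) : Z i ∈ pencilEigenvectors (homBlockL k) (curveInterior Φ Ψ) := by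
    refine ⟨z i, hmem i, fun a => (z i).1 ^ (a : ℕ) * (z i).2 ^ (a.rev : ℕ), fun μ ν => ?_⟩
    ext a
    rw [homBlockL_mulVec, hZ, projVandermonde_apply, projVandermonde_apply, Fin.rev_castSucc,
      Fin.rev_succ, Fin.val_castSucc, Fin.val_succ, Fin.val_succ, Fin.val_castSucc, Pi.smul_apply,
      smul_eq_mul]
    ring
  have hli : LinearIndependent ℂ Z.row :=
    linearIndependent_rows_iff_isUnit.mpr ((isUnit_iff_isUnit_det Z).mpr hZdet.isUnit)
  rw [eq_top_iff, ← hli.span_eq_top_of_card_eq_finrank (by simp)]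
  exact Submodule.span_mono (Set.range_subset_iff.mpr hrow)

end SingularBlock

/-! ### Kronecker forms -/

theorem vecMul_submatrix_injective {R q κ : Type*} [CommRing R] [Fintype q] [DecidableEq q]
    [Fintype κ] {M : Matrix q q R} (hM : IsUnit M.det) {e : κ → q} (he : Function.Injective e) :
    Function.Injective (M.submatrix e id).vecMul :=
  vecMul_injective_iff.mpr
    ((linearIndependent_rows_of_isUnit ((isUnit_iff_isUnit_det M).mpr hM)).comp e he)

namespace KroneckerForm

variable {p n : ℕ} {F G : Matrix (Fin p) (Fin n) ℂ} {Φ Ψ : Matrix (Fin 2) (Fin 2) ℂ}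

/-- The rows of the block matrix of a Kronecker form. -/
abbrev RowIdx (K : KroneckerForm F G) : Type :=
  (Σ i : Fin K.l, Fin (K.η i + 1)) ⊕ (Fin K.m ⊕ (Σ j : Fin K.r, Fin (K.ε j)))

/-- The columns of the block matrix of a Kronecker form. -/
abbrev ColIdx (K : KroneckerForm F G) : Type :=
  (Σ i : Fin K.l, Fin (K.η i)) ⊕ (Fin K.m ⊕ (Σ j : Fin K.r, Fin (K.ε j + 1)))

/-- The block matrix of a Kronecker form in homogeneous coordinates: the canonical form of
`μ G - ν F`. -/
def blocks (K : KroneckerForm F G) (μ ν : ℂ) : Matrix K.RowIdx K.ColIdx ℂ :=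
  fromBlocks (blockDiagonal' fun i => (homBlockL (K.η i) μ ν)ᵀ) 0 0
    (fromBlocks (μ • K.B - ν • K.A) 0 0 (blockDiagonal' fun j => homBlockL (K.ε j) μ ν))

theorem blocks_eq_smul_add_smul (K : KroneckerForm F G) (μ ν : ℂ) :
    K.blocks μ ν = μ • K.blocks 1 0 + ν • K.blocks 0 1 := by
  have hη : (fun i => (homBlockL (K.η i) μ ν)ᵀ) =
      μ • (fun i => (homBlockL (K.η i) (1 : ℂ) 0)ᵀ) +
        ν • fun i => (homBlockL (K.η i) (0 : ℂ) 1)ᵀ := by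
    funext i
    rw [homBlockL_eq_smul_add_smul]
    rfl
  have hε : (fun j => homBlockL (K.ε j) μ ν) =
      μ • (fun j => homBlockL (K.ε j) (1 : ℂ) 0) + ν • fun j => homBlockL (K.ε j) (0 : ℂ) 1 :=
    funext fun j => homBlockL_eq_smul_add_smul (K.ε j) μ ν
  have hreg : μ • K.B - ν • K.A =
      μ • ((1 : ℂ) • K.B - (0 : ℂ) • K.A) + ν • ((0 : ℂ) • K.B - (1 : ℂ) • K.A) := by
    module
  simp only [blocks, fromBlocks_smul, fromBlocks_add, ← blockDiagonal'_smul,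
    ← blockDiagonal'_add, smul_zero, add_zero, ← hη, ← hε, ← hreg]

theorem mul_pencil_mul (K : KroneckerForm F G) (μ ν : ℂ) :
    K.P * (μ • G - ν • F) * K.Q = reindex K.rowEquiv K.colEquiv (K.blocks μ ν) := by
  have hone (z : ℂ) :
      K.P * (z • G - F) * K.Q = reindex K.rowEquiv K.colEquiv (K.blocks z 1) := by
    rw [K.eq_blocks z, blocks, one_smul]
    rfl
  have hF : -(K.P * F * K.Q) = reindex K.rowEquiv K.colEquiv (K.blocks 0 1) := by
    simpa using hone 0
  have hG : K.P * G * K.Q = reindex K.rowEquiv K.colEquiv (K.blocks 1 0) := by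
    have h := hone 1
    rw [K.blocks_eq_smul_add_smul 1 1, one_smul, one_smul, one_smul, Matrix.mul_sub,
      Matrix.sub_mul, sub_eq_add_neg, hF] at h
    exact add_right_cancel h
  rw [K.blocks_eq_smul_add_smul, sub_eq_add_neg, ← smul_neg, Matrix.mul_add, Matrix.add_mul,
    Matrix.mul_smul, Matrix.mul_smul, Matrix.smul_mul, Matrix.smul_mul, Matrix.mul_neg,
    Matrix.neg_mul, hF, hG]
  rfl

theorem rank_eq_iff (K : KroneckerForm F G) {μ ν : ℂ} (hμν : (μ, ν) ≠ 0) :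
    (μ • G - ν • F).rank = p ↔ K.l = 0 ∧ (μ • K.B - ν • K.A).det ≠ 0 := by
  have hrank : (μ • G - ν • F).rank = (K.blocks μ ν).rank := by
    rw [← rank_reindex K.rowEquiv K.colEquiv, ← K.mul_pencil_mul,
      rank_mul_eq_left_of_isUnit_det _ _ K.isUnit_Q,
      rank_mul_eq_right_of_isUnit_det _ _ K.isUnit_P]
  have hcard : Fintype.card K.RowIdx = p := by
    rw [Fintype.card_congr K.rowEquiv, Fintype.card_fin]
  have hl : (∀ i, Function.Injective (homBlockL (K.η i) μ ν)ᵀ.vecMul) ↔ K.l = 0 := by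
    simp only [not_vecMul_transpose_homBlockL_injective, ← isEmpty_iff,
      ← Fintype.card_eq_zero_iff, Fintype.card_fin]
  have hε (j : Fin K.r) : Function.Injective (homBlockL (K.ε j) μ ν).vecMul :=
    vecMul_homBlockL_injective hμν
  calc (μ • G - ν • F).rank = p ↔ Function.Injective (K.blocks μ ν).vecMul := by
        rw [← rank_eq_card_iff_vecMul_injective, hcard, hrank]
    _ ↔ K.l = 0 ∧ (μ • K.B - ν • K.A).det ≠ 0 := by
        rw [blocks, vecMul_fromBlocks_zero_injective_iff, vecMul_fromBlocks_zero_injective_iff,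
          vecMul_blockDiagonal'_injective_iff, vecMul_blockDiagonal'_injective_iff, hl,
          and_iff_left hε, vecMul_injective_iff_isUnit, isUnit_iff_isUnit_det, isUnit_iff_ne_zero]

theorem exists_det_ne_zero (K : KroneckerForm F G) : ∃ z : ℂ, (z • K.B - K.A).det ≠ 0 :=
  pencilDet_ne_zero_iff.mp K.regular

theorem normalRank_eq_iff (K : KroneckerForm F G) : normalRank F G = p ↔ K.l = 0 := by
  have hrank (z : ℂ) : (z • G - F).rank = p ↔ K.l = 0 ∧ (z • K.B - K.A).det ≠ 0 := by
    simpa using K.rank_eq_iff (μ := z) (ν := 1) (by simp)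
  simp only [PencilFeasibility.normalRank_eq_iff, hrank, exists_and_left,
    and_iff_left K.exists_det_ne_zero]

theorem forall_rank_eq_iff (K : KroneckerForm F G) :
    (∀ μ ν : ℂ, (μ, ν) ≠ 0 → (μ • G - ν • F).rank = p) ↔ K.l = 0 ∧ K.m = 0 := by
  constructor
  · intro h
    refine ⟨((K.rank_eq_iff (by simp)).mp (h 1 1 (by simp))).1, Nat.eq_zero_of_not_pos fun hm => ?_⟩
    obtain ⟨μ, ν, hμν, hdet⟩ := exists_det_eq_zero_of_pos hm K.A K.B
    exact ((K.rank_eq_iff hμν).mp (h μ ν hμν)).2 hdet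
  · rintro ⟨hl, hm⟩ μ ν hμν
    have : IsEmpty (Fin K.m) := hm ▸ Fin.isEmpty
    exact (K.rank_eq_iff hμν).mpr ⟨hl, by rw [det_isEmpty]; exact one_ne_zero⟩

theorem exists_compression (K : KroneckerForm F G) :
    ∃ (R : Matrix (Fin K.m) (Fin p) ℂ) (C : Matrix (Fin K.m) (Fin n) ℂ),
      R * F = K.A * C ∧ R * G = K.B * C ∧
        Function.Injective R.vecMul ∧ Function.Injective C.vecMul := by
  set R := K.P.submatrix (K.rowEquiv ∘ Sum.inr ∘ Sum.inl) id
  set C := K.Q⁻¹.submatrix (K.colEquiv ∘ Sum.inr ∘ Sum.inl) id with hC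
  have hinj : Function.Injective (Sum.inr ∘ Sum.inl : Fin K.m → K.RowIdx) :=
    Sum.inr_injective.comp Sum.inl_injective
  have hinj' : Function.Injective (Sum.inr ∘ Sum.inl : Fin K.m → K.ColIdx) :=
    Sum.inr_injective.comp Sum.inl_injective
  have hRC (μ ν : ℂ) : R * (μ • G - ν • F) = (μ • K.B - ν • K.A) * C := by
    have hP : K.P * (μ • G - ν • F) = reindex K.rowEquiv K.colEquiv (K.blocks μ ν) * K.Q⁻¹ := by
      rw [← K.mul_pencil_mul, mul_nonsing_inv_cancel_right _ _ K.isUnit_Q]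
    ext i k
    calc (R * (μ • G - ν • F)) i k
        = (K.P * (μ • G - ν • F)) (K.rowEquiv (Sum.inr (Sum.inl i))) k := rfl
      _ = ∑ c, K.blocks μ ν (Sum.inr (Sum.inl i)) c * K.Q⁻¹ (K.colEquiv c) k := by
          rw [hP, mul_apply, ← Equiv.sum_comp K.colEquiv]
          simp only [reindex_apply, submatrix_apply, Equiv.symm_apply_apply]
      _ = ((μ • K.B - ν • K.A) * C) i k := by
          simp [blocks, mul_apply, hC]
  refine ⟨R, C, by simpa using hRC 0 (-1), by simpa using hRC 1 0, ?_, ?_⟩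
  · exact vecMul_submatrix_injective K.isUnit_P (K.rowEquiv.injective.comp hinj)
  · exact vecMul_submatrix_injective (isUnit_nonsing_inv_det_iff.mpr K.isUnit_Q)
      (K.colEquiv.injective.comp hinj')

theorem nondefective_and_eigenvaluesIn (K : KroneckerForm F G) (hΦ : Φ.IsHermitian)
    (hΨ : Ψ.IsHermitian) (hdet : Φ.det ≠ 0) (h : ∃ X, StrictlyFeasible Φ Ψ F G X) :
    Nondefective K.A K.B ∧ EigenvaluesIn K.A K.B (curveInterior Φ Ψ) := by
  obtain ⟨X, hX⟩ := h
  obtain ⟨R, C, hF, hG, hR, hC⟩ := K.exists_compression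
  obtain ⟨c, hc⟩ := K.exists_det_ne_zero
  have hY := hX.compress hF hG hR hC
  exact ⟨hY.nondefective hΦ hdet hc, hY.eigenvaluesIn hΦ hΨ hc⟩

theorem span_pencilEigenvectors_eq_top_of_blocks (K : KroneckerForm F G) {S : Set (ℂ × ℂ)}
    (h : Submodule.span ℂ (pencilEigenvectors K.blocks S) = ⊤) :
    Submodule.span ℂ (pencilEigenvectors (fun μ ν => μ • G - ν • F) S) = ⊤ := by
  have hQ (μ ν : ℂ) : (μ • G - ν • F) * K.Q.submatrix id K.colEquiv =
      K.P⁻¹.submatrix id K.rowEquiv * K.blocks μ ν := by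
    calc (μ • G - ν • F) * K.Q.submatrix id K.colEquiv
        = (K.P⁻¹ * (K.P * (μ • G - ν • F) * K.Q)).submatrix id K.colEquiv := by
          rw [Matrix.mul_assoc K.P, nonsing_inv_mul_cancel_left _ _ K.isUnit_P]
          rfl
      _ = K.P⁻¹.submatrix id K.rowEquiv * K.blocks μ ν := by
          rw [K.mul_pencil_mul, ← submatrix_mul_equiv _ _ id K.rowEquiv, reindex_apply,
            submatrix_submatrix, Equiv.symm_comp_self, Equiv.symm_comp_self, submatrix_id_id]
  refine Submodule.eq_top_iff'.mpr fun v => ?_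
  have hmem := mulVec_mem_span_pencilEigenvectors hQ h ((K.Q⁻¹ *ᵥ v) ∘ K.colEquiv)
  rwa [submatrix_mulVec_equiv, Function.comp_assoc, Equiv.self_comp_symm, Function.comp_id,
    Function.comp_id, mulVec_mulVec, mul_nonsing_inv _ K.isUnit_Q, one_mulVec] at hmem

theorem span_pencilEigenvectors_blocks (K : KroneckerForm F G) {S : Set (ℂ × ℂ)} (hl : K.l = 0)
    (hreg : Submodule.span ℂ (pencilEigenvectors (fun μ ν => μ • K.B - ν • K.A) S) = ⊤)
    (hsing : ∀ k, Submodule.span ℂ (pencilEigenvectors (homBlockL k) S) = ⊤) :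
    Submodule.span ℂ (pencilEigenvectors K.blocks S) = ⊤ := by
  have : IsEmpty (Fin K.l) := hl ▸ Fin.isEmpty
  rw [eq_top_iff, ← (Pi.basisFun ℂ K.ColIdx).span_eq, Submodule.span_le, Set.range_subset_iff]
  rintro (⟨i, _⟩ | b | ⟨j, b⟩)
  · exact (IsEmpty.false i).elim
  · rw [Pi.basisFun_apply]
    refine single_mem_span_pencilEigenvectors (e := Sum.inr ∘ Sum.inl) (f := Sum.inr ∘ Sum.inl)
      (Sum.inr_injective.comp Sum.inl_injective) (by simp [blocks]) ?_ hreg b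
    rintro μ ν (i | a | i) hi b
    · simp [blocks]
    · exact absurd ⟨a, rfl⟩ hi
    · simp [blocks]
  · rw [Pi.basisFun_apply]
    refine single_mem_span_pencilEigenvectors (T' := K.blocks) (T := homBlockL (K.ε j))
      (e := fun a => Sum.inr (Sum.inr ⟨j, a⟩)) (f := fun b => Sum.inr (Sum.inr ⟨j, b⟩))
      (Sum.inr_injective.comp (Sum.inr_injective.comp sigma_mk_injective)) (by simp [blocks]) ?_
      (hsing (K.ε j)) b
    rintro μ ν (i | i | ⟨j', a⟩) hi b
    · simp [blocks]
    · simp [blocks]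
    · have hj : j' ≠ j := by
        rintro rfl
        exact hi ⟨a, rfl⟩
      exact blockDiagonal'_apply_ne (fun j => homBlockL (K.ε j) μ ν) a b hj

theorem exists_strictlyFeasible (K : KroneckerForm F G) (hΦ : Φ.IsHermitian)
    (hΨ : Ψ.IsHermitian) (hdet : Φ.det ≠ 0) (hC : HasTwoPoints (curve Φ Ψ))
    (hrank : normalRank F G = p) (hnd : Nondefective K.A K.B)
    (heig : EigenvaluesIn K.A K.B (curveInterior Φ Ψ)) : ∃ X, StrictlyFeasible Φ Ψ F G X := by
  obtain ⟨x, y, hxy⟩ := hC.exists_isArcFrame hΦ hΨ hdet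
  obtain ⟨c, hc⟩ := K.exists_det_ne_zero
  have hreg := span_pencilEigenvectors_of_nondefective hc hnd
    fun μ ν hμν h => heig.mem_curveInterior hΦ hΨ hμν h
  have hblocks := K.span_pencilEigenvectors_blocks (K.normalRank_eq_iff.mp hrank) hreg
    (hxy.span_pencilEigenvectors_homBlockL hΦ hΨ hdet)
  exact PencilFeasibility.exists_strictlyFeasible hΦ hΨ hrank
    (K.span_pencilEigenvectors_eq_top_of_blocks hblocks)

end KroneckerForm

/-! ### Existence of Kronecker forms -/

section BiorthogonalFamilies

open Module

variable {ι κ 𝕜 V : Type*} [DecidableEq ι] [Field 𝕜] [AddCommGroup V] [Module 𝕜 V]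
  {v : ι → V} {y : ι → Dual 𝕜 V}

theorem linearIndependent_of_biorthogonal (h : ∀ i j, y i (v j) = (1 : Matrix ι ι 𝕜) i j) :
    LinearIndependent 𝕜 v :=
  .of_pairwise_dual_eq_zero_one v y (fun i j hij => (h i j).trans (one_apply_ne hij))
    fun i => (h i i).trans (one_apply_eq i)

variable [Finite ι]

theorem isCompl_span_ker_pi (h : ∀ i j, y i (v j) = (1 : Matrix ι ι 𝕜) i j) :
    IsCompl (Submodule.span 𝕜 (Set.range v)) (LinearMap.ker (LinearMap.pi y)) := by
  cases nonempty_fintype ι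
  have hcoeff (c : ι → 𝕜) (i : ι) : y i (∑ j, c j • v j) = c i := by
    simp [h, one_apply]
  refine ⟨Submodule.disjoint_def.mpr fun u hu hyu => ?_,
    Submodule.codisjoint_iff_exists_add_eq.mpr fun u =>
      ⟨∑ j, y j u • v j, u - ∑ j, y j u • v j, ?_, ?_, add_sub_cancel _ _⟩⟩
  · obtain ⟨c, rfl⟩ := Submodule.mem_span_range_iff_exists_fun 𝕜 |>.mp hu
    have hc (i : ι) : c i = 0 := (hcoeff c i).symm.trans (congrFun hyu i)
    simp [hc]
  · exact Submodule.sum_smul_mem _ _ fun i _ => Submodule.subset_span ⟨i, rfl⟩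
  · exact funext fun i => by simp [hcoeff]

theorem exists_basis_of_biorthogonal (h : ∀ i j, y i (v j) = (1 : Matrix ι ι 𝕜) i j)
    (b : Basis κ 𝕜 (LinearMap.ker (LinearMap.pi y))) :
    ∃ b' : Basis (ι ⊕ κ) 𝕜 V, (∀ i, b' (.inl i) = v i) ∧ ∀ k, b' (.inr k) = b k := by
  have hv := linearIndependent_of_biorthogonal h
  refine ⟨((Basis.span hv).prod b).map (Submodule.prodEquivOfIsCompl _ _ (isCompl_span_ker_pi h)),
    fun i => ?_, fun k => ?_⟩ <;>
  simp [Basis.span_apply]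

end BiorthogonalFamilies

theorem eq_one_of_shift {R : Type*} [Zero R] [One R] {e : ℕ}
    {M : Matrix (Fin (e + 1)) (Fin (e + 1)) R} (hzero : M 0 0 = 1)
    (hshift : ∀ i j : Fin e, M i.succ j.succ = M i.castSucc j.castSucc)
    (hcol : ∀ i : Fin e, M i.succ 0 = 0) (hlast : ∀ i : Fin e, M i.castSucc (Fin.last e) = 0) :
    M = 1 := by
  have hupper (j i : Fin (e + 1)) (hij : i < j) : M i j = 0 := by
    induction j using Fin.reverseInduction generalizing i with
    | last =>
      obtain ⟨i, rfl⟩ := Fin.exists_castSucc_eq.mpr hij.ne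
      exact hlast i
    | cast j ih =>
      obtain ⟨i, rfl⟩ := Fin.exists_castSucc_eq.mpr (hij.trans (Fin.castSucc_lt_last j)).ne
      rw [← hshift]
      exact ih i.succ (Fin.succ_lt_succ_iff.mpr hij)
  ext i j
  induction j using Fin.induction generalizing i with
  | zero => cases i using Fin.cases <;> simp [hzero, hcol, one_apply]
  | succ j ih =>
    cases i using Fin.cases with
    | zero => rw [hupper _ _ j.succ_pos, one_apply_ne j.succ_ne_zero.symm]
    | succ i => rw [hshift, ih]; simp [one_apply]

section Chains

open Module

variable {𝕜 V W : Type*} [Field 𝕜] [AddCommGroup V] [Module 𝕜 V] [AddCommGroup W] [Module 𝕜 W]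
  {f g : V →ₗ[𝕜] W} {e : ℕ}

/-- The families `v` and `w` span a block `L_e` of the pencil `λ g - f`: this pencil maps `v k`
to `λ w k - w (k - 1)`, where the terms out of range are zero. -/
structure IsChain (f g : V →ₗ[𝕜] W) {e : ℕ} (v : Fin (e + 1) → V) (w : Fin e → W) : Prop where
  f_zero : f (v 0) = 0
  f_succ : ∀ k, f (v k.succ) = w k
  g_castSucc : ∀ k, g (v k.castSucc) = w k
  g_last : g (v (Fin.last e)) = 0

/-- The families `x` and `y` of linear forms are adapted to the pencil `λ g - f` so that, if
biorthogonal to a chain, their common kernels are a complement of it that is stable under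
`f` and `g`. -/
structure IsDualChain (f g : V →ₗ[𝕜] W) {e : ℕ} (y : Fin (e + 1) → Dual 𝕜 V)
    (x : Fin e → Dual 𝕜 W) : Prop where
  comp_f : ∀ i, x i ∘ₗ f = y i.succ
  comp_g : ∀ i, x i ∘ₗ g = y i.castSucc

/-- The coefficients of the vector polynomial `(f - λ g) v(λ)`, in terms of those of `v(λ)`. -/
def pencilShift (f g : V →ₗ[𝕜] W) (k : ℕ) : (Fin k → V) →ₗ[𝕜] (Fin (k + 1) → W) :=
  ∑ i, (LinearMap.single 𝕜 (fun _ => W) i.castSucc ∘ₗ f -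
    LinearMap.single 𝕜 (fun _ => W) i.succ ∘ₗ g) ∘ₗ LinearMap.proj i

theorem pencilShift_apply {k : ℕ} (v : Fin k → V) :
    pencilShift f g k v =
      Fin.snoc (α := fun _ => W) (f ∘ v) 0 - Fin.cons (α := fun _ => W) 0 (g ∘ v) := by
  have hf : ∑ i, Pi.single (M := fun _ => W) i.castSucc (f (v i)) = Fin.snoc (f ∘ v) 0 := by
    ext j
    cases j using Fin.lastCases <;> simp [Pi.single_apply]
  have hg : ∑ i, Pi.single (M := fun _ => W) i.succ (g (v i)) = Fin.cons 0 (g ∘ v) := by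
    ext j
    cases j using Fin.cases <;> simp [Pi.single_apply]
  simp [pencilShift, hf, hg]

theorem pencilShift_single {k : ℕ} (i : Fin k) (a : V) :
    pencilShift f g k (Pi.single i a) = Pi.single i.castSucc (f a) - Pi.single i.succ (g a) := by
  rw [pencilShift, LinearMap.sum_apply,
    Finset.sum_eq_single i (fun j _ hj => by simp [hj]) (by simp)]
  simp

theorem pencilShift_cons {k : ℕ} (a : V) (u : Fin k → V) :
    pencilShift f g (k + 1) (Fin.cons a u) =
      Fin.cons (f a) (pencilShift f g k u - Pi.single 0 (g a)) := by
  rw [pencilShift_apply, pencilShift_apply, Fin.comp_cons, Fin.comp_cons,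
    ← Fin.cons_snoc_eq_snoc_cons]
  ext i
  cases i using Fin.cases with
  | zero => simp
  | succ i => cases i using Fin.cases <;> simp

theorem isChain_of_pencilShift_eq_zero {v : Fin (e + 1) → V} (hv : pencilShift f g (e + 1) v = 0) :
    IsChain f g v fun k => g (v k.castSucc) := by
  rw [pencilShift_apply, sub_eq_zero] at hv
  refine ⟨?_, fun k => ?_, fun _ => rfl, ?_⟩
  · simpa using congrFun hv (Fin.castSucc 0)
  · have h := congrFun hv k.succ.castSucc
    rwa [Fin.snoc_castSucc, ← Fin.succ_castSucc, Fin.cons_succ] at h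
  · have h := congrFun hv (Fin.last (e + 1))
    rw [Fin.snoc_last, ← Fin.succ_last, Fin.cons_succ] at h
    exact h.symm

theorem exists_not_injective_pencilShift [FiniteDimensional 𝕜 V] [FiniteDimensional 𝕜 W]
    (f g : V →ₗ[𝕜] W) (h : finrank 𝕜 W < finrank 𝕜 V) :
    ∃ k, ¬Function.Injective (pencilShift f g k) := by
  refine ⟨finrank 𝕜 W + 1, fun hinj => ?_⟩
  have hle := LinearMap.finrank_le_finrank_of_injective hinj
  rw [finrank_pi_fintype, finrank_pi_fintype, Fin.sum_const, Fin.sum_const, smul_eq_mul,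
    smul_eq_mul] at hle
  nlinarith

theorem head_ne_zero_of_pencilShift_eq_zero {v : Fin (e + 1) → V}
    (hinj : Function.Injective (pencilShift f g e)) (hv : pencilShift f g (e + 1) v = 0)
    (hv0 : v ≠ 0) : v 0 ≠ 0 := by
  intro h0
  rw [← Fin.cons_self_tail v, pencilShift_cons, h0, map_zero, map_zero, Pi.single_zero,
    sub_zero] at hv
  have htail : Fin.tail v = 0 := hinj ((congrArg Fin.tail hv).trans (map_zero _).symm)
  rw [← Fin.cons_self_tail v, h0, htail] at hv0
  exact hv0 cons_zero_zero

theorem exists_isDualChain {v : Fin (e + 1) → V} (hinj : Function.Injective (pencilShift f g e))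
    (hv : pencilShift f g (e + 1) v = 0) (hv0 : v ≠ 0) :
    ∃ y x, IsDualChain f g (e := e) y x ∧ y 0 (v 0) = 1 := by
  have hhead := head_ne_zero_of_pencilShift_eq_zero hinj hv hv0
  cases e with
  | zero =>
    obtain ⟨φ, hφ⟩ := Projective.exists_dual_eq_one 𝕜 hhead
    exact ⟨fun _ => φ, isEmptyElim, ⟨isEmptyElim, isEmptyElim⟩, hφ⟩
  | succ k =>
    have hrange : Pi.single 0 (g (v 0)) ∉ LinearMap.range (pencilShift f g k) := by
      rintro ⟨u, hu⟩
      have hcons : pencilShift f g (k + 1) (Fin.cons (v 0) u) = 0 := by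
        rw [pencilShift_cons, hu, sub_self, (isChain_of_pencilShift_eq_zero hv).f_zero]
        exact cons_zero_zero
      exact hhead (by simpa using congrFun (hinj (hcons.trans (map_zero _).symm)) 0)
    obtain ⟨X, hX, hX1⟩ := LinearMap.exists_extend_of_notMem (0 : _ →ₗ[𝕜] 𝕜) hrange 1
    have hXS (i : Fin k) (a : V) :
        X (Pi.single i.castSucc (f a)) = X (Pi.single i.succ (g a)) := by
      rw [← sub_eq_zero, ← map_sub, ← pencilShift_single]
      exact LinearMap.congr_fun hX ⟨_, _, rfl⟩
    let x : Fin (k + 1) → Dual 𝕜 W := fun i => X ∘ₗ LinearMap.single 𝕜 (fun _ => W) i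
    refine ⟨Fin.cons (x 0 ∘ₗ g) fun i => x i ∘ₗ f, x, ⟨fun i => rfl, fun i => ?_⟩, hX1⟩
    cases i using Fin.cases with
    | zero => rfl
    | succ i =>
      ext a
      exact (hXS i a).symm

theorem exists_isChain_isDualChain [FiniteDimensional 𝕜 V] [FiniteDimensional 𝕜 W]
    (f g : V →ₗ[𝕜] W) (h : finrank 𝕜 W < finrank 𝕜 V) :
    ∃ (e : ℕ) (v : Fin (e + 1) → V) (w : Fin e → W) (y : Fin (e + 1) → Dual 𝕜 V)
      (x : Fin e → Dual 𝕜 W), IsChain f g v w ∧ IsDualChain f g y x ∧ y 0 (v 0) = 1 := by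
  classical
  have hex := exists_not_injective_pencilShift f g h
  obtain ⟨e, he⟩ : ∃ e, Nat.find hex = e + 1 := by
    refine Nat.exists_eq_succ_of_ne_zero fun h0 => Nat.find_spec hex ?_
    rw [h0]
    exact Function.injective_of_subsingleton _
  have hmin : Function.Injective (pencilShift f g e) :=
    not_not.mp (Nat.find_min hex (he ▸ e.lt_succ_self))
  have hker := he ▸ Nat.find_spec hex
  rw [← LinearMap.ker_eq_bot, ← ne_eq, Submodule.ne_bot_iff] at hker
  obtain ⟨v, hv, hv0⟩ := hker
  obtain ⟨y, x, hyx, hy⟩ := exists_isDualChain hmin hv hv0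
  exact ⟨e, v, _, y, x, isChain_of_pencilShift_eq_zero hv, hyx, hy⟩

theorem IsDualChain.biorthogonal_domain {y : Fin (e + 1) → Dual 𝕜 V} {x : Fin e → Dual 𝕜 W}
    {v : Fin (e + 1) → V} {w : Fin e → W} (hyx : IsDualChain f g y x) (hvw : IsChain f g v w)
    (hy : y 0 (v 0) = 1) (i j : Fin (e + 1)) :
    y i (v j) = (1 : Matrix (Fin (e + 1)) (Fin (e + 1)) 𝕜) i j := by
  refine congrFun₂ (eq_one_of_shift (M := fun i j => y i (v j)) hy (fun i j => ?_) (fun i => ?_)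
    fun i => ?_) i j
  · rw [← hyx.comp_f, ← hyx.comp_g, LinearMap.comp_apply, LinearMap.comp_apply, hvw.f_succ,
      hvw.g_castSucc]
  · rw [← hyx.comp_f, LinearMap.comp_apply, hvw.f_zero, map_zero]
  · rw [← hyx.comp_g, LinearMap.comp_apply, hvw.g_last, map_zero]

theorem IsDualChain.biorthogonal_codomain {y : Fin (e + 1) → Dual 𝕜 V} {x : Fin e → Dual 𝕜 W}
    {v : Fin (e + 1) → V} {w : Fin e → W} (hyx : IsDualChain f g y x) (hvw : IsChain f g v w)
    (hy : y 0 (v 0) = 1) (i j : Fin e) :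
    x i (w j) = (1 : Matrix (Fin e) (Fin e) 𝕜) i j := by
  rw [← hvw.f_succ, ← LinearMap.comp_apply, hyx.comp_f, hyx.biorthogonal_domain hvw hy, one_apply,
    one_apply]
  simp only [Fin.succ_inj]

end Chains

section KroneckerBases

open Module

theorem surjective_restrict_of_disjoint {R V W : Type*} [Ring R] [AddCommGroup V] [Module R V]
    [AddCommGroup W] [Module R W] {T : V →ₗ[R] W} (hT : Function.Surjective T)
    {V₁ V₂ : Submodule R V} {W₁ W₂ : Submodule R W} (hV : Codisjoint V₁ V₂) (hW : Disjoint W₁ W₂)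
    (h₁ : ∀ a ∈ V₁, T a ∈ W₁) (h₂ : ∀ a ∈ V₂, T a ∈ W₂) : Function.Surjective (T.restrict h₂) := by
  rintro ⟨b, hb⟩
  obtain ⟨a, rfl⟩ := hT b
  obtain ⟨a₁, a₂, ha₁, ha₂, rfl⟩ := Submodule.codisjoint_iff_exists_add_eq.mp hV a
  have hzero : T a₁ = 0 := Submodule.disjoint_def.mp hW _ (h₁ a₁ ha₁) <| by
    simpa using W₂.sub_mem hb (h₂ a₂ ha₂)
  exact ⟨⟨a₂, ha₂⟩, Subtype.ext (by simp [hzero])⟩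

variable {𝕜 V W : Type*} [Field 𝕜] [AddCommGroup V] [Module 𝕜 V] [AddCommGroup W] [Module 𝕜 W]
  {f g : V →ₗ[𝕜] W} {e : ℕ} {v : Fin (e + 1) → V} {w : Fin e → W} {y : Fin (e + 1) → Dual 𝕜 V}
  {x : Fin e → Dual 𝕜 W}

theorem IsDualChain.map_f_mem_ker (hyx : IsDualChain f g y x) :
    ∀ a ∈ LinearMap.ker (LinearMap.pi y), f a ∈ LinearMap.ker (LinearMap.pi x) :=
  fun a ha => funext fun i => (LinearMap.congr_fun (hyx.comp_f i) a).trans (congrFun ha i.succ)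

theorem IsDualChain.map_g_mem_ker (hyx : IsDualChain f g y x) :
    ∀ a ∈ LinearMap.ker (LinearMap.pi y), g a ∈ LinearMap.ker (LinearMap.pi x) :=
  fun a ha =>
    funext fun i => (LinearMap.congr_fun (hyx.comp_g i) a).trans (congrFun ha i.castSucc)

theorem IsChain.pencil_apply (hvw : IsChain f g v w) (z : 𝕜) (k : Fin (e + 1)) :
    (z • g - f) (v k) = ∑ i, homBlockL e z 1 i k • w i := by
  have hf : f (v k) = ∑ i, (if k = i.succ then (1 : 𝕜) else 0) • w i := by
    cases k using Fin.cases with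
    | zero => simp [hvw.f_zero, (Fin.succ_ne_zero _).symm]
    | succ k => simp [hvw.f_succ]
  have hg : g (v k) = ∑ i, (if k = i.castSucc then (1 : 𝕜) else 0) • w i := by
    cases k using Fin.lastCases with
    | last => simp [hvw.g_last, (Fin.castSucc_ne_last _).symm]
    | cast k => simp [hvw.g_castSucc]
  rw [LinearMap.sub_apply, LinearMap.smul_apply, hf, hg, Finset.smul_sum,
    ← Finset.sum_sub_distrib]
  refine Finset.sum_congr rfl fun i _ => ?_
  rw [smul_smul, ← sub_smul]
  have hne : i.castSucc ≠ i.succ := Fin.castSucc_lt_succ.ne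
  congr 1
  simp only [homBlockL, of_apply]
  split_ifs <;> simp_all

theorem IsChain.pencil_mem_span (hvw : IsChain f g v w) (z : 𝕜) :
    ∀ a ∈ Submodule.span 𝕜 (Set.range v), (z • g - f) a ∈ Submodule.span 𝕜 (Set.range w) := by
  suffices Submodule.span 𝕜 (Set.range v) ≤ (Submodule.span 𝕜 (Set.range w)).comap (z • g - f)
    from fun a ha => this ha
  rw [Submodule.span_le]
  rintro _ ⟨k, rfl⟩
  rw [SetLike.mem_coe, Submodule.mem_comap, hvw.pencil_apply]
  exact Submodule.sum_smul_mem _ _ fun i _ => Submodule.subset_span ⟨i, rfl⟩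

theorem IsChain.of_restrict {V₀ : Submodule 𝕜 V} {W₀ : Submodule 𝕜 W}
    {hf : ∀ a ∈ V₀, f a ∈ W₀} {hg : ∀ a ∈ V₀, g a ∈ W₀} {v : Fin (e + 1) → V₀} {w : Fin e → W₀}
    (h : IsChain (f.restrict hf) (g.restrict hg) v w) :
    IsChain f g (fun k => (v k : V)) fun k => (w k : W) where
  f_zero := congrArg Subtype.val h.f_zero
  f_succ k := congrArg Subtype.val (h.f_succ k)
  g_castSucc k := congrArg Subtype.val (h.g_castSucc k)
  g_last := congrArg Subtype.val h.g_last

theorem IsDualChain.surjective_pencil_restrict (hyx : IsDualChain f g y x) (hvw : IsChain f g v w)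
    (hy : y 0 (v 0) = 1) {z : 𝕜} (hz : Function.Surjective (z • g - f)) :
    Function.Surjective (z • g.restrict hyx.map_g_mem_ker - f.restrict hyx.map_f_mem_ker) :=
  surjective_restrict_of_disjoint hz
    (isCompl_span_ker_pi (hyx.biorthogonal_domain hvw hy)).codisjoint
    (isCompl_span_ker_pi (hyx.biorthogonal_codomain hvw hy)).disjoint (hvw.pencil_mem_span z)
    fun a ha => Submodule.sub_mem _ (Submodule.smul_mem _ z (hyx.map_g_mem_ker a ha))
      (hyx.map_f_mem_ker a ha)

/-- Collects the summand `t none` and the summands `t (some j)` into one disjoint union indexed by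
`Option J`, as needed when a block is split off from a Kronecker form. -/
def insertEquiv {J : Type*} (M : Type*) (t : Option J → Type*) :
    (t none ⊕ (M ⊕ Σ j, t (some j))) ≃ (M ⊕ Σ j, t j) where
  toFun
    | .inl a => .inr ⟨none, a⟩
    | .inr (.inl i) => .inl i
    | .inr (.inr ⟨j, a⟩) => .inr ⟨some j, a⟩
  invFun
    | .inl i => .inr (.inl i)
    | .inr ⟨none, a⟩ => .inl a
    | .inr ⟨some j, a⟩ => .inr (.inr ⟨j, a⟩)
  left_inv := by rintro (a | i | ⟨j, a⟩) <;> rfl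
  right_inv := by rintro (i | ⟨_ | j, a⟩) <;> rfl

/-- Bases of the domain and the codomain in which the pencil `λ g - f` is block diagonal with
blocks `λ B - A` and `L_{ε j}`. -/
structure IsKroneckerBasis (f g : V →ₗ[𝕜] W) {M J : Type*} [Fintype M] {ε : J → ℕ}
    (A B : Matrix M M 𝕜) (bV : Basis (M ⊕ Σ j, Fin (ε j + 1)) 𝕜 V)
    (bW : Basis (M ⊕ Σ j, Fin (ε j)) 𝕜 W) : Prop where
  f_inl : ∀ i, f (bV (.inl i)) = ∑ k, A k i • bW (.inl k)
  g_inl : ∀ i, g (bV (.inl i)) = ∑ k, B k i • bW (.inl k)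
  chain : ∀ j, IsChain f g (fun k => bV (.inr ⟨j, k⟩)) fun k => bW (.inr ⟨j, k⟩)

theorem IsKroneckerBasis.reindex {M J J' : Type*} [Fintype M] {ε : J → ℕ} {A B : Matrix M M 𝕜}
    {bV : Basis (M ⊕ Σ j, Fin (ε j + 1)) 𝕜 V} {bW : Basis (M ⊕ Σ j, Fin (ε j)) 𝕜 W}
    (h : IsKroneckerBasis f g A B bV bW) (s : J' ≃ J) :
    IsKroneckerBasis (ε := ε ∘ s) f g A B
      (bV.reindex (.symm (.sumCongr (.refl M)
        (.sigmaCongrLeft (β := fun j => Fin (ε j + 1)) s))))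
      (bW.reindex (.symm (.sumCongr (.refl M)
        (.sigmaCongrLeft (β := fun j => Fin (ε j)) s)))) where
  f_inl i := by simpa using h.f_inl i
  g_inl i := by simpa using h.g_inl i
  chain j := by simpa using h.chain (s j)

theorem exists_isKroneckerBasis_of_bijective [FiniteDimensional 𝕜 V] [FiniteDimensional 𝕜 W]
    {z : 𝕜} (hz : Function.Bijective (z • g - f)) (ε : Fin 0 → ℕ) :
    ∃ (A B : Matrix (Fin (finrank 𝕜 V)) (Fin (finrank 𝕜 V)) 𝕜)
      (bV : Basis (_ ⊕ Σ j, Fin (ε j + 1)) 𝕜 V) (bW : Basis (_ ⊕ Σ j, Fin (ε j)) 𝕜 W),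
      (z • B - A).det ≠ 0 ∧ IsKroneckerBasis f g A B bV bW := by
  let bV := finBasis 𝕜 V
  let bW := bV.map (LinearEquiv.ofBijective _ hz)
  refine ⟨LinearMap.toMatrix bV bW f, LinearMap.toMatrix bV bW g,
    bV.reindex (Equiv.sumEmpty _ _).symm, bW.reindex (Equiv.sumEmpty _ _).symm, ?_,
    ⟨fun i => ?_, fun i => ?_, isEmptyElim⟩⟩
  · rw [← map_smul, ← map_sub]
    exact (LinearEquiv.isUnit_det (LinearEquiv.ofBijective _ hz) bV bW).ne_zero
  all_goals
    simp only [Basis.reindex_apply, Equiv.symm_symm, Equiv.sumEmpty_apply_inl,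
      LinearMap.toMatrix_apply]
    exact (bW.sum_repr _).symm

theorem exists_isKroneckerBasis_of_restrict (hyx : IsDualChain f g y x) (hvw : IsChain f g v w)
    (hy : y 0 (v 0) = 1) {M J : Type*} [Fintype M] {ε : J → ℕ} {A B : Matrix M M 𝕜}
    {bV : Basis (M ⊕ Σ j, Fin (ε j + 1)) 𝕜 (LinearMap.ker (LinearMap.pi y))}
    {bW : Basis (M ⊕ Σ j, Fin (ε j)) 𝕜 (LinearMap.ker (LinearMap.pi x))}
    (h : IsKroneckerBasis (f.restrict hyx.map_f_mem_ker) (g.restrict hyx.map_g_mem_ker) A B bV bW) :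
    ∃ (bV' : Basis (M ⊕ Σ j : Option J, Fin (j.elim e ε + 1)) 𝕜 V)
      (bW' : Basis (M ⊕ Σ j : Option J, Fin (j.elim e ε)) 𝕜 W),
      IsKroneckerBasis (ε := fun j : Option J => j.elim e ε) f g A B bV' bW' := by
  obtain ⟨bV', hV, hV'⟩ := exists_basis_of_biorthogonal (hyx.biorthogonal_domain hvw hy) bV
  obtain ⟨bW', hW, hW'⟩ := exists_basis_of_biorthogonal (hyx.biorthogonal_codomain hvw hy) bW
  refine ⟨bV'.reindex (insertEquiv M fun j : Option J => Fin (j.elim e ε + 1)),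
    bW'.reindex (insertEquiv M fun j : Option J => Fin (j.elim e ε)),
    fun i => ?_, fun i => ?_, ?_⟩
  · simpa [insertEquiv, hV', hW'] using congrArg Subtype.val (h.f_inl i)
  · simpa [insertEquiv, hV', hW'] using congrArg Subtype.val (h.g_inl i)
  · rintro (_ | j)
    · simpa [insertEquiv, hV, hW] using hvw
    · simpa [insertEquiv, hV', hW'] using (h.chain j).of_restrict

theorem exists_isKroneckerBasis {𝕜 : Type*} [Field 𝕜] (N : ℕ) :
    ∀ (V W : Type*) [AddCommGroup V] [Module 𝕜 V] [AddCommGroup W] [Module 𝕜 W]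
      [FiniteDimensional 𝕜 V] [FiniteDimensional 𝕜 W] (f g : V →ₗ[𝕜] W) (z : 𝕜),
    finrank 𝕜 V = N → Function.Surjective (z • g - f) →
    ∃ (m r : ℕ) (ε : Fin r → ℕ) (A B : Matrix (Fin m) (Fin m) 𝕜)
      (bV : Basis (Fin m ⊕ Σ j, Fin (ε j + 1)) 𝕜 V) (bW : Basis (Fin m ⊕ Σ j, Fin (ε j)) 𝕜 W),
      (z • B - A).det ≠ 0 ∧ IsKroneckerBasis f g A B bV bW := by
  induction N using Nat.strong_induction_on with
  | _ N ih =>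
  rintro V W _ _ _ _ _ _ f g z rfl hz
  rcases le_or_gt (finrank 𝕜 V) (finrank 𝕜 W) with hle | hlt
  · have heq := le_antisymm hle (LinearMap.finrank_le_finrank_of_surjective hz)
    exact ⟨_, 0, isEmptyElim, exists_isKroneckerBasis_of_bijective
      ⟨(LinearMap.injective_iff_surjective_of_finrank_eq_finrank heq).mpr hz, hz⟩ _⟩
  · obtain ⟨e, v, w, y, x, hvw, hyx, hy⟩ := exists_isChain_isDualChain f g hlt
    have hker : LinearMap.ker (LinearMap.pi y) ≠ ⊤ := fun h => by
      have hv : v 0 ∈ LinearMap.ker (LinearMap.pi y) := h ▸ Submodule.mem_top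
      exact one_ne_zero (hy.symm.trans (congrFun hv 0))
    obtain ⟨m, r, ε, A, B, bV, bW, hdet, h⟩ := ih _ (Submodule.finrank_lt hker) _ _ _ _ z rfl
      (hyx.surjective_pencil_restrict hvw hy hz)
    obtain ⟨bV', bW', h'⟩ := exists_isKroneckerBasis_of_restrict hyx hvw hy h
    exact ⟨m, r + 1, _, A, B, _, _, hdet, h'.reindex (finSuccEquiv r)⟩

theorem IsKroneckerBasis.pencil_eq_toLin {M J : Type*} [Fintype M] [DecidableEq M] [Fintype J]
    [DecidableEq J] {ε : J → ℕ} {A B : Matrix M M 𝕜} {bV : Basis (M ⊕ Σ j, Fin (ε j + 1)) 𝕜 V}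
    {bW : Basis (M ⊕ Σ j, Fin (ε j)) 𝕜 W} (h : IsKroneckerBasis f g A B bV bW) (z : 𝕜) :
    z • g - f = toLin bV bW
      (fromBlocks (z • B - A) 0 0 (blockDiagonal' fun j => homBlockL (ε j) z 1)) := by
  refine bV.ext ?_
  rintro (i | ⟨j, k⟩)
  · simp [toLin_self, h.f_inl, h.g_inl, sub_smul, Finset.smul_sum, smul_smul]
  · rw [(h.chain j).pencil_apply, toLin_self, Fintype.sum_sum_type, Fintype.sum_sigma,
      Finset.sum_eq_single j (fun i _ hij => ?_) (by simp)]
    · simp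
    · exact Finset.sum_eq_zero fun a _ => by
        rw [fromBlocks_apply₂₂, blockDiagonal'_apply_ne _ _ _ hij, zero_smul]

end KroneckerBases

section KroneckerForms

open Module

theorem toMatrix_reindex_mul_mul_toMatrix_reindex {ι κ ι' κ' R : Type*} [CommRing R] [Fintype ι]
    [Fintype κ] [DecidableEq κ] [Finite ι'] [Fintype κ'] [DecidableEq κ'] {T : Matrix ι κ R}
    {N : Matrix ι' κ' R} {bV : Basis κ' R (κ → R)} {bW : Basis ι' R (ι → R)}
    (h : T.toLin' = toLin bV bW N) (eW : ι' ≃ ι) (eV : κ' ≃ κ) :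
    (bW.reindex eW).toMatrix (Pi.basisFun R ι) * T * (Pi.basisFun R κ).toMatrix (bV.reindex eV) =
      reindex eW eV N := by
  classical
  cases nonempty_fintype ι'
  have hT : T = LinearMap.toMatrix (Pi.basisFun R κ) (Pi.basisFun R ι) (toLin bV bW N) := by
    rw [← h]
    exact (LinearMap.toMatrix'_toLin' T).symm
  rw [hT, basis_toMatrix_mul_linearMap_toMatrix_mul_basis_toMatrix]
  ext i k
  rw [LinearMap.toMatrix_apply, Basis.reindex_apply, Basis.repr_reindex_apply,
    ← LinearMap.toMatrix_apply, LinearMap.toMatrix_toLin]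
  rfl

variable {p n : ℕ} {F G : Matrix (Fin p) (Fin n) ℂ}

theorem nonempty_kroneckerForm_of_isKroneckerBasis {m r : ℕ} {ε : Fin r → ℕ}
    {A B : Matrix (Fin m) (Fin m) ℂ} {bV : Basis (Fin m ⊕ Σ j, Fin (ε j + 1)) ℂ (Fin n → ℂ)}
    {bW : Basis (Fin m ⊕ Σ j, Fin (ε j)) ℂ (Fin p → ℂ)}
    (h : IsKroneckerBasis F.toLin' G.toLin' A B bV bW) (hreg : pencilDet A B ≠ 0) :
    Nonempty (KroneckerForm F G) := by
  let eV := bV.indexEquiv (Pi.basisFun ℂ (Fin n))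
  let eW := bW.indexEquiv (Pi.basisFun ℂ (Fin p))
  refine ⟨{
    l := 0
    η := Fin.elim0
    m := m
    A := A
    B := B
    r := r
    ε := ε
    P := (bW.reindex eW).toMatrix (Pi.basisFun ℂ (Fin p))
    Q := (Pi.basisFun ℂ (Fin n)).toMatrix (bV.reindex eV)
    rowEquiv := (Equiv.emptySum _ _).trans eW
    colEquiv := (Equiv.emptySum _ _).trans eV
    isUnit_P := by simpa only [Basis.det_apply] using (bW.reindex eW).isUnit_det (Pi.basisFun ℂ _)
    isUnit_Q := by simpa only [Basis.det_apply] using (Pi.basisFun ℂ _).isUnit_det (bV.reindex eV)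
    regular := hreg
    eq_blocks := fun z => ?_ }⟩
  have hz : (z • G - F).toLin' = z • G.toLin' - F.toLin' := by rw [map_sub, map_smul]
  rw [toMatrix_reindex_mul_mul_toMatrix_reindex (hz.trans (h.pencil_eq_toLin z))]
  rfl

theorem exists_kroneckerForm (h : normalRank F G = p) : Nonempty (KroneckerForm F G) := by
  obtain ⟨z, hz⟩ := PencilFeasibility.normalRank_eq_iff.mp h
  have hsurj : Function.Surjective (z • G.toLin' - F.toLin') := by
    rw [← map_smul, ← map_sub, ← LinearMap.range_eq_top]
    exact Submodule.eq_top_of_finrank_eq (hz.trans (finrank_fin_fun ℂ).symm)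
  obtain ⟨m, r, ε, A, B, bV, bW, hdet, hbasis⟩ :=
    exists_isKroneckerBasis _ _ _ F.toLin' G.toLin' z rfl hsurj
  exact nonempty_kroneckerForm_of_isKroneckerBasis hbasis (pencilDet_ne_zero_iff.mpr ⟨z, hdet⟩)

end KroneckerForms

section

variable {p n m : ℕ} {F G : Matrix (Fin p) (Fin n) ℂ} {Φ Ψ : Matrix (Fin 2) (Fin 2) ℂ}

theorem nondefective_of_isEmpty [IsEmpty (Fin m)] (A B : Matrix (Fin m) (Fin m) ℂ) :
    Nondefective A B :=
  ⟨fun _ h => absurd (det_isEmpty.symm.trans h) one_ne_zero,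
    fun h => absurd (det_isEmpty.symm.trans h) one_ne_zero⟩

theorem eigenvaluesIn_of_isEmpty [IsEmpty (Fin m)] (A B : Matrix (Fin m) (Fin m) ℂ)
    (S : Set (ℂ × ℂ)) : EigenvaluesIn A B S :=
  ⟨fun _ h => absurd (det_isEmpty.symm.trans h) one_ne_zero,
    fun h => absurd (det_isEmpty.symm.trans h) one_ne_zero⟩

theorem normalRank_eq_of_forall_rank_eq (h : ∀ μ ν : ℂ, (μ, ν) ≠ 0 → (μ • G - ν • F).rank = p) :
    normalRank F G = p :=
  normalRank_eq_iff.mpr ⟨1, by simpa using h 1 1 (by simp)⟩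

theorem KroneckerForm.exists_strictlyFeasible_iff (K : KroneckerForm F G) (hΦ : Φ.IsHermitian)
    (hΨ : Ψ.IsHermitian) (hdet : Φ.det ≠ 0) (hC : HasTwoPoints (curve Φ Ψ))
    (hrow : IsRedundant Φ Ψ → (fromCols F G).rank = p) :
    (∃ X, StrictlyFeasible Φ Ψ F G X) ↔ normalRank F G = p ∧ Nondefective K.A K.B ∧
      EigenvaluesIn K.A K.B (curveInterior Φ Ψ) :=
  ⟨fun h => ⟨h.elim fun _ hX => hX.normalRank_eq hΦ hΨ hdet (hX.vecMul_fromCols_injective hrow),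
    K.nondefective_and_eigenvaluesIn hΦ hΨ hdet h⟩,
    fun ⟨hrank, hnd, heig⟩ => K.exists_strictlyFeasible hΦ hΨ hdet hC hrank hnd heig⟩

theorem exists_strictlyFeasible_of_forall_rank_eq (hΦ : Φ.IsHermitian) (hΨ : Ψ.IsHermitian)
    (hdet : Φ.det ≠ 0) (hC : HasTwoPoints (curve Φ Ψ))
    (h : ∀ μ ν : ℂ, (μ, ν) ≠ 0 → (μ • G - ν • F).rank = p) :
    ∃ X, StrictlyFeasible Φ Ψ F G X := by
  have hrank := normalRank_eq_of_forall_rank_eq h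
  obtain ⟨K⟩ := exists_kroneckerForm hrank
  have hm : IsEmpty (Fin K.m) := by
    rw [(K.forall_rank_eq_iff.mp h).2]
    infer_instance
  exact K.exists_strictlyFeasible hΦ hΨ hdet hC hrank (nondefective_of_isEmpty _ _)
    (eigenvaluesIn_of_isEmpty _ _ _)

end

end PencilFeasibility

theorem mainTheorem6 {p n : ℕ} (F G : Matrix (Fin p) (Fin n) ℂ)
    (Φ Ψ : Matrix (Fin 2) (Fin 2) ℂ) (hΦ : Φ.IsHermitian) (hΨ : Ψ.IsHermitian)
    (hdet : Φ.det.re < 0)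
    (hC : PencilFeasibility.HasTwoPoints (PencilFeasibility.curve Φ Ψ))
    (hrow : PencilFeasibility.IsRedundant Φ Ψ → (Matrix.fromCols F G).rank = p) :
    ((∃ X, PencilFeasibility.StrictlyFeasible Φ Ψ F G X) ↔
      PencilFeasibility.normalRank F G = p ∧
      ∃ K : PencilFeasibility.KroneckerForm F G,
        PencilFeasibility.Nondefective K.A K.B ∧
        PencilFeasibility.EigenvaluesIn K.A K.B (PencilFeasibility.curveInterior Φ Ψ)) ∧
    (∀ K : PencilFeasibility.KroneckerForm F G,
      ((∃ X, PencilFeasibility.StrictlyFeasible Φ Ψ F G X) ↔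
        PencilFeasibility.normalRank F G = p ∧
        PencilFeasibility.Nondefective K.A K.B ∧
        PencilFeasibility.EigenvaluesIn K.A K.B (PencilFeasibility.curveInterior Φ Ψ)) ∧
      (PencilFeasibility.normalRank F G = p ↔ K.l = 0) ∧
      ((∀ μ ν : ℂ, (μ, ν) ≠ 0 → (μ • G - ν • F).rank = p) ↔ K.l = 0 ∧ K.m = 0)) ∧
    ((∀ μ ν : ℂ, (μ, ν) ≠ 0 → (μ • G - ν • F).rank = p) →
      ∃ X, PencilFeasibility.StrictlyFeasible Φ Ψ F G X) := by
  have hdet' : Φ.det ≠ 0 := fun h => hdet.ne (congrArg Complex.re h)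
  have hiff (K : PencilFeasibility.KroneckerForm F G) :=
    K.exists_strictlyFeasible_iff hΦ hΨ hdet' hC hrow
  refine ⟨⟨fun ⟨X, hX⟩ => ?_, fun ⟨hrank, K, hK⟩ => (hiff K).mpr ⟨hrank, hK⟩⟩,
    fun K => ⟨hiff K, K.normalRank_eq_iff, K.forall_rank_eq_iff⟩,
    PencilFeasibility.exists_strictlyFeasible_of_forall_rank_eq hΦ hΨ hdet' hC⟩
  have hrank := hX.normalRank_eq hΦ hΨ hdet' (hX.vecMul_fromCols_injective hrow)
  obtain ⟨K⟩ := PencilFeasibility.exists_kroneckerForm hrank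
  exact ⟨hrank, K, ((hiff K).mp ⟨X, hX⟩).2⟩
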